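/- Let $\Omega\subset\mathbb R^3$ be a bounded open set with Lipschitz boundary: every $p\in\partial\Omega$ has a ball $B_r(p)$ in which, after a linear isometric change of coordinates, $\Omega$ is the set of points lying strictly above the graph of a Lipschitz function of two variables. Let $(\nu_\varepsilon)_{\varepsilon>0}$ be a family of functions $\nu_\varepsilon:\mathbb R^3\to\mathbb R^3$ such that (H1) for every $\varepsilon>0$, $\nu_\varepsilon(-y)=-\nu_\varepsilon(y)$ for all $y\in\mathbb R^3$, $\nu_\varepsilon\in L^1(\mathbb R^3;\mathbb R^3)$ and $\|\nu_\varepsilon\|_{L^1(\mathbb R^3)}=1$; (H2) for every $\delta>0$, $\lim_{\varepsilon\to0^+}\int_{\mathbb R^3\setminus B_\delta(0)}|\nu_\varepsilon(y)|\,dy=0$; (H3) for $i=1,2,3$ the limit $d_i:=\lim_{\varepsilon\to0^+}\int_{\mathbb R^3}\nu_\varepsilon(y)\,\frac{y_i}{|y|}\,dy\in\mathbb R^3$ exists. Put $$\mathcal H_\varepsilon(m)=\iint_{\Omega\times\Omega}\frac{\nu_\varepsilon(x-y)}{|x-y|}\cdot\bigl(m(x)\times m(y)\bigr)\,dx\,dy,\qquad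 \mathcal H(m)=\sum_{i=1}^3\int_\Omega m(x)\cdot\bigl(d_i\times\partial_i m(x)\bigr)\,dx .$$ (i) For every $m\in H^1(\Omega;\mathbb R^3)$, with weak partial derivatives $\partial_i m$, the integrals defining $\mathcal H_\varepsilon(m)$, for every $\varepsilon>0$, and $\mathcal H(m)$ converge absolutely, and $\lim_{\varepsilon\to0^+}\mathcal H_\varepsilon(m)=\mathcal H(m)$. (ii) Let $C^2(\overline\Omega;\mathbb R^3)$ be the space of maps that are $C^2$ in $\Omega$ and whose derivatives of order at most $2$ extend continuously to $\overline\Omega$, with the norm given by the suprema of these derivatives. If $(m_\varepsilon)_{\varepsilon>0}$ is a family in $C^2(\overline\Omega;\mathbb R^3)$ and $m_\varepsilon\to m$ in $C^2(\overline\Omega;\mathbb R^3)$ as $\varepsilon\to0^+$, then the integrals defining $\mathcal H_\varepsilon(m_\varepsilon)$, for every $\varepsilon>0$, and $\mathcal H(m)$ converge absolutely, and $\lim_{\varepsilon\to0^+}\mathcal H_\varepsilon(m_\varepsilon)=\mathcal H(m)$. -/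

import Mathlib

open Filter Topology MeasureTheory
open scoped Matrix

noncomputable section

namespace NonlocalDMI

/-- Three-dimensional space with its Euclidean norm and Lebesgue measure. -/
abbrev R3 := EuclideanSpace ℝ (Fin 3)

/-- The `i`-th vector of the standard basis. -/
def e (i : Fin 3) : R3 := EuclideanSpace.single i 1

/-- The vector product of `u` and `v`. -/
def cross (u v : R3) : R3 := WithLp.toLp 2 (u.ofLp ⨯₃ v.ofLp)

/-- `Ω` has a Lipschitz boundary: near each boundary point, and after a rigid change of the axes,
`Ω` is the set of points strictly above the graph of a Lipschitz function of two variables. -/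
def HasLipschitzBoundary (Ω : Set R3) : Prop :=
  ∀ p ∈ frontier Ω, ∃ r > 0, ∃ (Φ : R3 ≃ₗᵢ[ℝ] R3) (γ : EuclideanSpace ℝ (Fin 2) → ℝ) (L : NNReal),
    LipschitzWith L γ ∧
      ∀ x ∈ Metric.ball p r, (x ∈ Ω ↔ γ !₂[Φ x 0, Φ x 1] < Φ x 2)

/-! Assumptions on a family of kernels `ν ε`, `ε > 0` (the values of `ν` at `ε ≤ 0` are ignored). -/

/-- Each kernel is odd, integrable, and of unit mass in `L¹`. -/
def OddUnitMass (ν : ℝ → R3 → R3) : Prop :=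
  ∀ ε > 0, (∀ y, ν ε (-y) = -ν ε y) ∧ Integrable (ν ε) ∧ ∫ y, ‖ν ε y‖ = 1

/-- The mass concentrates at the origin as `ε → 0⁺`. -/
def ConcentratesAtZero (ν : ℝ → R3 → R3) : Prop :=
  ∀ δ > 0, Tendsto (fun ε => ∫ y in (Metric.ball (0 : R3) δ)ᶜ, ‖ν ε y‖) (𝓝[>] 0) (𝓝 0)

/-- The vectors `d i` are the limits of the first directional moments of the kernels. -/
def HasDzyaloshinskiiVectors (ν : ℝ → R3 → R3) (d : Fin 3 → R3) : Prop :=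
  ∀ i, Tendsto (fun ε => ∫ y : R3, (y i / ‖y‖) • ν ε y) (𝓝[>] 0) (𝓝 (d i))

/-! Function spaces. Maps on `Ω` are total functions of which only the values on `Ω` matter. -/

/-- `g` is the weak partial derivative of `m` in the direction `e i` on `Ω`. -/
def HasWeakPartialDeriv (Ω : Set R3) (i : Fin 3) (m g : R3 → R3) : Prop :=
  ∀ φ : R3 → ℝ, ContDiff ℝ ((⊤ : ℕ∞) : WithTop ℕ∞) φ → HasCompactSupport φ → tsupport φ ⊆ Ω →
    ∫ x in Ω, fderiv ℝ φ x (e i) • m x = -∫ x in Ω, φ x • g x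

/-- `m` belongs to `H¹(Ω; ℝ³)`, with weak partial derivatives `Dm 0`, `Dm 1`, `Dm 2`. -/
structure IsH1 (Ω : Set R3) (m : R3 → R3) (Dm : Fin 3 → R3 → R3) : Prop where
  memLp : MemLp m 2 (volume.restrict Ω)
  memLp_deriv : ∀ i, MemLp (Dm i) 2 (volume.restrict Ω)
  weakDeriv : ∀ i, HasWeakPartialDeriv Ω i m (Dm i)

/-- `m` belongs to `C²` of the closure of the open set `Ω`: it is `C²` in `Ω`, and its derivatives
of order at most `2` extend continuously to the closure. -/
def MemC2Closure (Ω : Set R3) (m : R3 → R3) : Prop :=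
  ContDiffOn ℝ 2 m Ω ∧ ∀ k ≤ 2, ∃ F : R3 → ContinuousMultilinearMap ℝ (fun _ : Fin k => R3) R3,
    ContinuousOn F (closure Ω) ∧ Set.EqOn F (iteratedFDeriv ℝ k m) Ω

/-- `mε → m` as `ε → 0⁺` in the norm of `C²` of the closure of the open set `Ω`. By continuity, the
supremum over the closure is the one over `Ω`. -/
def TendstoC2Closure (Ω : Set R3) (mε : ℝ → R3 → R3) (m : R3 → R3) : Prop :=
  ∀ k ≤ 2, TendstoUniformlyOn (fun ε => iteratedFDeriv ℝ k (mε ε)) (iteratedFDeriv ℝ k m)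
    (𝓝[>] 0) Ω

/-! The two energies. -/

/-- The integrand of the nonlocal antisymmetric energy with kernel `κ`. -/
def nonlocalIntegrand (κ : R3 → R3) (m : R3 → R3) (p : R3 × R3) : ℝ :=
  inner ℝ (‖p.1 - p.2‖⁻¹ • κ (p.1 - p.2)) (cross (m p.1) (m p.2))

/-- The nonlocal antisymmetric energy with kernel `κ`. -/
def nonlocalEnergy (Ω : Set R3) (κ : R3 → R3) (m : R3 → R3) : ℝ :=
  ∫ p in Ω ×ˢ Ω, nonlocalIntegrand κ m p

/-- The `i`-th integrand of the local energy of a map `m` with partial derivatives `Dm`. -/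
def dmiIntegrand (d : Fin 3 → R3) (m : R3 → R3) (Dm : Fin 3 → R3 → R3) (i : Fin 3) (x : R3) : ℝ :=
  inner ℝ (m x) (cross (d i) (Dm i x))

/-- The local energy of a map `m` with partial derivatives `Dm`. -/
def dmiEnergy (Ω : Set R3) (d : Fin 3 → R3) (m : R3 → R3) (Dm : Fin 3 → R3 → R3) : ℝ :=
  ∑ i, ∫ x in Ω, dmiIntegrand d m Dm i x

/-- The classical partial derivatives. -/
def classicalPartials (m : R3 → R3) (i : Fin 3) (x : R3) : R3 := fderiv ℝ m x (e i)

end NonlocalDMI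

end

open NonlocalDMI

/-! The singularity $1/|x-y|$ is compensated by antisymmetry. Adding and subtracting products of
components at $y$ turns each component of $m(x)\times m(y)$ into a difference of terms
$u(y)(f(x)-f(y))$, with $u,f$ components of $m$ (`nonlocalIntegrand_eq`). The substitution $x=y+h$
and Fubini then write the energy as a finite combination of integrals $\int\kappa(h)\,Q(h)\,dh$,
where $\kappa$ is a component of the kernel and $Q(h)=|h|^{-1}\int u(x)(f(x+h)-f(x))\,dx$ over those
$x$ with $x,x+h\in\Omega$ (`nonlocalForm_eq`).

Two facts about $Q$ suffice. It is bounded by a constant times $\|u\|_{L^2}\|f\|_{H^1}$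
(`exists_lpNorm_increment_le`), and $Q(h)-\sum_i\frac{h_i}{|h|}\int_\Omega u\,\partial_if\to0$ as
$h\to0$ (`exists_abs_integral_mul_increment_sub_le`). Concentration of the kernels kills the
contribution of large $h$, and the limits $d_i$ of the moments give the local energy
(`tendsto_nonlocalForm`).

The bound on $Q$ needs no extension operator. Points $x,x+h$ of a Lipschitz domain are joined inside
$\Omega$ by a broken line of three segments: away from the boundary, across by $h$, and back. Along
a segment contained in $\Omega$, the increment is estimated by duality with translated test
functions.

Since the bound is uniform over kernels of mass at most 1, the forms are continuous in $(u,f)$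
uniformly in $\varepsilon$. This handles families converging in $H^1$, of which constant families
and families converging in $C^2(\overline\Omega)$ are special cases. -/

namespace NonlocalDMI

/-! ### Hölder's inequality and elementary facts on $L^2$ norms. -/

section L2

variable {α : Type*} {mα : MeasurableSpace α} {μ : Measure α}

lemma lpNorm_two_sq {f : α → ℝ} (hf : MemLp f 2 μ) : lpNorm f 2 μ ^ 2 = ∫ x, f x ^ 2 ∂μ := by
  rw [lpNorm_eq_integral_norm_rpow_toReal (by simp) (by simp) hf.1]
  have : 0 ≤ ∫ x, f x ^ 2 ∂μ := integral_nonneg fun x => sq_nonneg _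
  simp only [ENNReal.toReal_ofNat, Real.rpow_ofNat, Real.norm_eq_abs, sq_abs]
  rw [← Real.rpow_natCast, ← Real.rpow_mul this]
  norm_num

lemma integrable_mul_of_memLp_two {f g : α → ℝ} (hf : MemLp f 2 μ) (hg : MemLp g 2 μ) :
    Integrable (fun x => f x * g x) μ :=
  hf.integrable_mul hg

lemma integral_abs_mul_le {f g : α → ℝ} (hf : MemLp f 2 μ) (hg : MemLp g 2 μ) :
    ∫ x, |f x * g x| ∂μ ≤ lpNorm f 2 μ * lpNorm g 2 μ := by
  have := integral_mul_norm_le_Lp_mul_Lq (μ := μ) (f := f) (g := g) Real.HolderConjugate.two_two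
    (by simpa using hf) (by simpa using hg)
  rw [lpNorm_eq_integral_norm_rpow_toReal (by simp) (by simp) hf.1,
    lpNorm_eq_integral_norm_rpow_toReal (by simp) (by simp) hg.1]
  simpa [abs_mul] using this

lemma abs_integral_mul_le {f g : α → ℝ} (hf : MemLp f 2 μ) (hg : MemLp g 2 μ) :
    |∫ x, f x * g x ∂μ| ≤ lpNorm f 2 μ * lpNorm g 2 μ :=
  (abs_integral_le_integral_abs).trans (integral_abs_mul_le hf hg)

lemma lpNorm_mono_ae {f g : α → ℝ} (hg : MemLp g 2 μ) (h : ∀ᵐ x ∂μ, |f x| ≤ |g x|) :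
    lpNorm f 2 μ ≤ lpNorm g 2 μ := by
  by_cases hf : AEStronglyMeasurable f μ
  · rw [← toReal_eLpNorm hf, ← toReal_eLpNorm hg.1]
    exact ENNReal.toReal_mono hg.2.ne (eLpNorm_mono_ae h)
  · rw [lpNorm_of_not_aestronglyMeasurable hf]
    exact lpNorm_nonneg

lemma lpNorm_le_of_eLpNorm_le {f : α → ℝ} (hf : AEStronglyMeasurable f μ) {c : ℝ} (hc : 0 ≤ c)
    (h : eLpNorm f 2 μ ≤ ENNReal.ofReal c) : lpNorm f 2 μ ≤ c := by
  rw [← toReal_eLpNorm hf]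
  exact ENNReal.toReal_le_of_le_ofReal hc h

end L2

/-! ### Translation invariance of the $L^2$ norm. -/

section Translation

lemma memLp_comp_add {f : R3 → ℝ} (hf : MemLp f 2 volume) (h : R3) :
    MemLp (fun x => f (x + h)) 2 volume :=
  hf.comp_measurePreserving (measurePreserving_add_right volume h)

lemma lpNorm_comp_add {f : R3 → ℝ} (hf : MemLp f 2 volume) (h : R3) :
    lpNorm (fun x => f (x + h)) 2 volume = lpNorm f 2 volume := by
  rw [← toReal_eLpNorm (memLp_comp_add hf h).1, ← toReal_eLpNorm hf.1]
  congr 1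
  exact eLpNorm_comp_measurePreserving hf.1 (measurePreserving_add_right volume h)

end Translation

/-! ### Density of test functions in $L^2$ of an open set, and duality. -/

section Density

/-- A smooth cutoff between a compact set and an open set containing it. -/
lemma exists_smooth_cutoff {K A : Set R3} (hK : IsCompact K) (hA : IsOpen A) (hKA : K ⊆ A) :
    ∃ χ : R3 → ℝ, ContDiff ℝ ((⊤ : ℕ∞) : WithTop ℕ∞) χ ∧ HasCompactSupport χ ∧ tsupport χ ⊆ A ∧
      (∀ x, χ x ∈ Set.Icc (0 : ℝ) 1) ∧ ∀ x ∈ K, χ x = 1 := by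
  obtain ⟨K', hK', hKK', hK'A⟩ := exists_compact_between hK hA hKA
  obtain ⟨χ, h1, h2, h3, h4⟩ := exists_contMDiff_support_eq_eq_one_iff (n := ⊤)
    (modelWithCornersSelf ℝ R3) isOpen_interior hK.isClosed hKK'
  have hs : tsupport χ ⊆ K' :=
    closure_minimal (h3.subset.trans interior_subset) hK'.isClosed
  exact ⟨χ, h1.contDiff, HasCompactSupport.of_support_subset_isCompact hK'
    (h3.subset.trans interior_subset), hs.trans hK'A, fun x => h2 ⟨x, rfl⟩, fun x hx => (h4 x).1 hx⟩

/-- Test functions supported in an open set `A` are dense in `L²(A)`. -/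
lemma exists_testFunction_lpNorm_sub_le {A : Set R3} (hA : IsOpen A) (hA' : volume A ≠ ⊤)
    {F : R3 → ℝ} (hF : MemLp F 2 volume) (hF0 : ∀ x ∉ A, F x = 0) {η : ℝ} (hη : 0 < η) :
    ∃ φ : R3 → ℝ, ContDiff ℝ ((⊤ : ℕ∞) : WithTop ℕ∞) φ ∧ HasCompactSupport φ ∧ tsupport φ ⊆ A ∧
      lpNorm (F - φ) 2 volume ≤ η := by
  -- Absolute continuity of the integral: with $K$ filling $A$ up to measure $\delta$, truncating
  -- $F$ to $K$ costs at most $\eta/2$.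
  obtain ⟨δ, hδ, hδ'⟩ := hF.eLpNorm_indicator_le (by norm_num) (by norm_num) (half_pos hη)
  obtain ⟨K, hKA, hK, hKδ⟩ := hA.measurableSet.exists_isCompact_sdiff_lt hA'
    (ENNReal.ofReal_pos.2 hδ).ne'
  obtain ⟨χ, hχ, hχc, hχA, hχ01, hχK⟩ := exists_smooth_cutoff hK hA hKA
  have hFK : MemLp (K.indicator F) 2 volume := hF.indicator hK.measurableSet
  obtain ⟨g, hg, hg', hgF⟩ := hFK.exist_eLpNorm_sub_le (by norm_num) (by norm_num) (half_pos hη)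
  have hgm : MemLp g 2 volume := hg'.continuous.memLp_of_hasCompactSupport hg
  have hφc : HasCompactSupport (fun x => χ x * g x) := hχc.mul_right
  have hφ : ContDiff ℝ ((⊤ : ℕ∞) : WithTop ℕ∞) (fun x => χ x * g x) := hχ.mul hg'
  have hφm : MemLp (fun x => χ x * g x) 2 volume :=
    hφ.continuous.memLp_of_hasCompactSupport hφc
  refine ⟨fun x => χ x * g x, hφ, hφc, (tsupport_mul_subset_left).trans hχA, ?_⟩
  have e1 : F - (fun x => χ x * g x) = (F - K.indicator F) + (K.indicator F - fun x => χ x * g x) := by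
    abel
  rw [e1]
  have m1 : MemLp (F - K.indicator F) 2 volume := hF.sub hFK
  refine (lpNorm_add_le m1 (by norm_num)).trans ?_
  have b1 : lpNorm (F - K.indicator F) 2 volume ≤ η / 2 := by
    refine lpNorm_le_of_eLpNorm_le m1.1 (half_pos hη).le ?_
    have : F - K.indicator F = (A \ K).indicator F := by
      ext x
      by_cases hx : x ∈ K
      · simp [hx]
      · by_cases hxA : x ∈ A
        · simp [hx, hxA]
        · simp [hx, hxA, hF0 x hxA]
    rw [this]
    exact hδ' _ (hA.measurableSet.diff hK.measurableSet) hKδ.le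
  -- Multiplying $g$ by $\chi$ does not worsen the approximation: nothing changes on $K$, and off
  -- $K$ the target vanishes while $|\chi g|\le|g|$.
  have b2 : lpNorm (K.indicator F - fun x => χ x * g x) 2 volume ≤ η / 2 := by
    refine (lpNorm_mono_ae (hFK.sub hgm) (Eventually.of_forall fun x => ?_)).trans
      (lpNorm_le_of_eLpNorm_le (hFK.sub hgm).1 (half_pos hη).le hgF)
    by_cases hx : x ∈ K
    · simp [hx, hχK x hx]
    · simp only [Pi.sub_apply, Set.indicator_of_notMem hx, zero_sub, abs_neg, abs_mul]
      rw [abs_of_nonneg (hχ01 x).1]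
      exact mul_le_of_le_one_left (abs_nonneg _) (hχ01 x).2
  linarith

/-- An `L²` bound by duality with test functions. -/
lemma lpNorm_le_of_testFunction {A : Set R3} (hA : IsOpen A) (hA' : volume A ≠ ⊤)
    {F : R3 → ℝ} (hF : MemLp F 2 volume) (hF0 : ∀ x ∉ A, F x = 0) {M : ℝ} (hM : 0 ≤ M)
    (h : ∀ φ : R3 → ℝ, ContDiff ℝ ((⊤ : ℕ∞) : WithTop ℕ∞) φ → HasCompactSupport φ →
      tsupport φ ⊆ A → |∫ x, φ x * F x| ≤ M * lpNorm φ 2 volume) :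
    lpNorm F 2 volume ≤ M := by
  set N := lpNorm F 2 volume with hN
  have hN0 : 0 ≤ N := lpNorm_nonneg
  -- Split $N^2=\int\varphi F+\int(F-\varphi)F$ with $\varphi$ within $\eta$ of $F$, so that
  -- $\|\varphi\|\le N+\eta$.
  have key : ∀ η > 0, N ^ 2 ≤ M * N + η * (M + N) := by
    intro η hη
    obtain ⟨φ, h1, h2, h3, h4⟩ := exists_testFunction_lpNorm_sub_le hA hA' hF hF0 hη
    have hφ : MemLp φ 2 volume := h1.continuous.memLp_of_hasCompactSupport h2
    have e1 : N ^ 2 = (∫ x, φ x * F x) + ∫ x, (F - φ) x * F x := by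
      rw [hN, lpNorm_two_sq hF, ← integral_add (integrable_mul_of_memLp_two hφ hF)
        (integrable_mul_of_memLp_two (hF.sub hφ) hF)]
      congr 1; ext x; simp; ring
    have e2 := h φ h1 h2 h3
    have e3 := abs_integral_mul_le (hF.sub hφ) hF
    have e4 : lpNorm φ 2 volume ≤ N + η := by
      have := lpNorm_le_lpNorm_add_lpNorm_sub hF (f := φ) (p := 2) (by norm_num)
      linarith
    have e5 := mul_le_mul_of_nonneg_left e4 hM
    have e6 := mul_le_mul_of_nonneg_right h4 hN0
    have := le_abs_self (∫ x, φ x * F x)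
    have := le_abs_self (∫ x, (F - φ) x * F x)
    nlinarith
  by_contra! hlt
  have hpos : 0 < N := hM.trans_lt hlt
  -- This $\eta$ makes the error term $\eta(M+N)$ equal to half of $N(N-M)>0$, whereas `key` bounds
  -- all of $N(N-M)$ by it.
  have := key (N * (N - M) / (2 * (M + N))) (by
    have : 0 < N - M := by linarith
    positivity)
  rw [div_mul_eq_mul_div, le_iff_lt_or_eq] at this
  have h2 : N * (N - M) * (M + N) / (2 * (M + N)) = N * (N - M) / 2 := by
    have : M + N ≠ 0 := by positivity
    field_simp
  rw [h2] at this
  have h3 : 0 < N * (N - M) := mul_pos hpos (by linarith)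
  rcases this with h | h <;> nlinarith

end Density

/-! ### Weak derivatives and increments along segments contained in the domain. -/

section WeakDerivative

/-- `f` belongs to `H¹(Ω)` with weak partial derivatives `g i`, all functions being extended by zero
outside `Ω`. -/
structure IsScalarH1 (Ω : Set R3) (f : R3 → ℝ) (g : Fin 3 → R3 → ℝ) : Prop where
  memLp : MemLp f 2 volume
  memLp_deriv : ∀ i, MemLp (g i) 2 volume
  eq_zero : ∀ x ∉ Ω, f x = 0
  weakDeriv : ∀ i (φ : R3 → ℝ), ContDiff ℝ ((⊤ : ℕ∞) : WithTop ℕ∞) φ → HasCompactSupport φ →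
    tsupport φ ⊆ Ω → ∫ x, fderiv ℝ φ x (e i) * f x = -∫ x, φ x * g i x

lemma IsScalarH1.integrable {Ω : Set R3} {f : R3 → ℝ} {g : Fin 3 → R3 → ℝ}
    (hf : IsScalarH1 Ω f g) (hΩ : MeasurableSet Ω) (hΩ' : volume Ω ≠ ⊤) : Integrable f := by
  have h1 : Ω.indicator f = f := by
    ext x
    by_cases hx : x ∈ Ω
    · simp [hx]
    · simp [hx, hf.eq_zero x hx]
  rw [← h1, integrable_indicator_iff hΩ]
  have : IsFiniteMeasure (volume.restrict Ω) := ⟨by simpa using hΩ'.lt_top⟩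
  exact (hf.memLp.restrict Ω).integrable (by norm_num)

lemma sum_smul_e (w : R3) : ∑ i, w i • e i = w := by
  ext j
  simp [e, Fin.sum_univ_three]
  fin_cases j <;> simp

lemma fderiv_apply_eq_sum (φ : R3 → ℝ) (x w : R3) :
    fderiv ℝ φ x w = ∑ i, w i * fderiv ℝ φ x (e i) := by
  conv_lhs => rw [← sum_smul_e w]
  simp [map_sum]

/-- The translates of a test function, tested against an `H¹` function, vary according to the weak
gradient. -/
lemma hasDerivAt_integral_translate {Ω : Set R3} {f : R3 → ℝ} {g : Fin 3 → R3 → ℝ}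
    (hf : IsScalarH1 Ω f g) (hfi : Integrable f) {φ : R3 → ℝ}
    (hφ : ContDiff ℝ ((⊤ : ℕ∞) : WithTop ℕ∞) φ) (hφc : HasCompactSupport φ) (w : R3) (t : ℝ)
    (ht : ∀ x ∈ tsupport φ, x + t • w ∈ Ω) :
    HasDerivAt (fun s : ℝ => ∫ x, φ (x - s • w) * f x)
      (∑ i, w i * ∫ x, φ (x - t • w) * g i x) t := by
  have hd : Continuous (fderiv ℝ φ) := hφ.continuous_fderiv (by simp)
  obtain ⟨C, hC⟩ := (hφc.fderiv (𝕜 := ℝ)).exists_bound_of_continuous hd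
  have hdiff : Differentiable ℝ φ := hφ.differentiable (by simp)
  have hmeas : ∀ s : ℝ, AEStronglyMeasurable (fun x => φ (x - s • w) * f x) volume := fun s =>
    (hφ.continuous.comp (by fun_prop : Continuous fun x : R3 => x - s • w)).aestronglyMeasurable.mul
      hfi.1
  obtain ⟨C0, hC0⟩ := hφc.exists_bound_of_continuous hφ.continuous
  have key := hasDerivAt_integral_of_dominated_loc_of_deriv_le (μ := (volume : Measure R3))
    (F := fun (s : ℝ) x => φ (x - s • w) * f x)
    (F' := fun (s : ℝ) x => fderiv ℝ φ (x - s • w) (-w) * f x) (x₀ := t) (s := Set.univ)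
    (bound := fun x => C * ‖w‖ * ‖f x‖) univ_mem (Eventually.of_forall hmeas)
    (hfi.bdd_mul (hφ.continuous.comp
      (by fun_prop : Continuous fun x : R3 => x - t • w)).aestronglyMeasurable
      (Eventually.of_forall fun x => hC0 _))
    (((hd.comp (by fun_prop : Continuous fun x : R3 => x - t • w)).clm_apply
      continuous_const).aestronglyMeasurable.mul hfi.1)
    (Eventually.of_forall fun x s _ => by
      rw [norm_mul]
      gcongr
      refine (ContinuousLinearMap.le_opNorm _ _).trans ?_
      rw [norm_neg]
      gcongr
      exact hC _)
    (hfi.norm.const_mul _)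
    (Eventually.of_forall fun x s _ => by
      have h1 : HasDerivAt (fun s : ℝ => x - s • w) (-w) s := by
        simpa using ((hasDerivAt_id s).smul_const w).const_sub x
      exact ((hdiff _).hasFDerivAt.comp_hasDerivAt s h1).mul_const (f x))
  refine key.2.congr_deriv (Eq.symm ?_)
  have hsupp : ∀ x, fderiv ℝ (fun y => φ (y - t • w)) x = fderiv ℝ φ (x - t • w) := fun x => by
    rw [fderiv_comp_sub]
  -- By `ht` the translate $\varphi(\cdot-tw)$ is still supported in $\Omega$, so it is an
  -- admissible test function.
  have hweak : ∀ i, ∫ x, fderiv ℝ φ (x - t • w) (e i) * f x = -∫ x, φ (x - t • w) * g i x := by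
    intro i
    have := hf.weakDeriv i (fun y => φ (y - t • w)) (hφ.comp (contDiff_id.sub contDiff_const))
      (hφc.comp_homeomorph (Homeomorph.subRight (t • w))) ?_
    · simpa only [hsupp] using this
    · intro x hx
      have : x - t • w ∈ tsupport φ := by
        have h2 := tsupport_comp_eq_preimage φ (Homeomorph.subRight (t • w))
        have h3 : x ∈ (Homeomorph.subRight (t • w)) ⁻¹' tsupport φ := h2 ▸ hx
        exact h3
      simpa using ht _ this
  have hint : ∀ i, Integrable (fun x => fderiv ℝ φ (x - t • w) (e i) * f x) := fun i =>
    hfi.bdd_mul ((hd.comp (by fun_prop : Continuous fun x : R3 => x - t • w)).clm_apply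
      continuous_const).aestronglyMeasurable (c := C * ‖e i‖)
      (Eventually.of_forall fun x => (ContinuousLinearMap.le_opNorm _ _).trans (by
        gcongr
        exact hC _))
  calc ∑ i, w i * ∫ x, φ (x - t • w) * g i x
      = ∑ i, -w i * ∫ x, fderiv ℝ φ (x - t • w) (e i) * f x := by
        refine Finset.sum_congr rfl fun i _ => ?_
        rw [hweak]; ring
    _ = ∫ x, ∑ i, -w i * (fderiv ℝ φ (x - t • w) (e i) * f x) := by
        rw [integral_finsetSum _ fun i _ => (hint i).const_mul _]
        simp only [integral_const_mul]
    _ = _ := by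
        congr 1; ext x
        rw [fderiv_apply_eq_sum, Finset.sum_mul]
        refine Finset.sum_congr rfl fun i _ => ?_
        simp; ring

/-- Mean value inequality on $[0,1]$ for $s\mapsto\int\varphi(x-sw)f(x)\,dx-sc$. The free constant
$c$ serves two purposes: $c=0$ bounds the increment, and the first-order term as $c$ bounds the
remainder. -/
lemma abs_integral_mul_translate_sub_le {Ω : Set R3} {f : R3 → ℝ} {g : Fin 3 → R3 → ℝ}
    (hf : IsScalarH1 Ω f g) (hfi : Integrable f) {φ : R3 → ℝ}
    (hφ : ContDiff ℝ ((⊤ : ℕ∞) : WithTop ℕ∞) φ) (hφc : HasCompactSupport φ) (w : R3)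
    (hw : ∀ t ∈ Set.Icc (0 : ℝ) 1, ∀ x ∈ tsupport φ, x + t • w ∈ Ω) {c M : ℝ}
    (hM : ∀ t ∈ Set.Icc (0 : ℝ) 1, |(∑ i, w i * ∫ x, φ (x - t • w) * g i x) - c| ≤ M) :
    |(∫ x, φ x * (f (x + w) - f x)) - c| ≤ M := by
  have hφm : MemLp φ 2 volume := hφ.continuous.memLp_of_hasCompactSupport hφc
  have h1 := norm_image_sub_le_of_norm_deriv_le_segment_01' (C := M)
    (f := fun s : ℝ => (∫ x, φ (x - s • w) * f x) - s * c)
    (f' := fun t => (∑ i, w i * ∫ x, φ (x - t • w) * g i x) - c)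
    (fun t ht => by
      have := (hasDerivAt_integral_translate hf hfi hφ hφc w t (hw t ht)).sub
        ((hasDerivAt_id t).mul_const c)
      rw [one_mul] at this
      exact this.hasDerivWithinAt)
    (fun t ht => hM t ⟨ht.1, ht.2.le⟩)
  have h2 : ∫ x, φ (x - w) * f x = ∫ x, φ x * f (x + w) := by
    rw [← integral_add_right_eq_self (fun x => φ (x - w) * f x) w]
    simp
  have h3 : ∫ x, φ x * (f (x + w) - f x) = (∫ x, φ x * f (x + w)) - ∫ x, φ x * f x := by
    rw [← integral_sub (integrable_mul_of_memLp_two hφm (memLp_comp_add hf.memLp w))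
      (integrable_mul_of_memLp_two hφm hf.memLp)]
    simp only [mul_sub]
  simp only [one_smul, zero_smul, sub_zero, one_mul, zero_mul] at h1
  rw [h3, ← h2, ← Real.norm_eq_abs, sub_right_comm]
  exact h1

/-- The sum of the `L²` norms of the partial derivatives. -/
noncomputable def gradNorm (g : Fin 3 → R3 → ℝ) : ℝ := ∑ i, lpNorm (g i) 2 volume

lemma gradNorm_nonneg (g : Fin 3 → R3 → ℝ) : 0 ≤ gradNorm g :=
  Finset.sum_nonneg fun _ _ => lpNorm_nonneg

lemma abs_apply_le_norm (w : R3) (i : Fin 3) : |w i| ≤ ‖w‖ := by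
  simpa using PiLp.norm_apply_le w i

lemma abs_sum_mul_integral_le {g : Fin 3 → R3 → ℝ} (hg : ∀ i, MemLp (g i) 2 volume) {φ : R3 → ℝ}
    (hφ : MemLp φ 2 volume) (w : R3) :
    |∑ i, w i * ∫ x, φ x * g i x| ≤ ‖w‖ * lpNorm φ 2 volume * gradNorm g := by
  refine (Finset.abs_sum_le_sum_abs _ _).trans ?_
  rw [gradNorm, Finset.mul_sum]
  refine Finset.sum_le_sum fun i _ => ?_
  rw [abs_mul, mul_assoc]
  exact mul_le_mul (abs_apply_le_norm w i) (abs_integral_mul_le hφ (hg i)) (abs_nonneg _)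
    (norm_nonneg _)

/-- Difference quotients of an `H¹` function along segments contained in the domain. -/
lemma lpNorm_indicator_translate_sub_le {Ω A : Set R3} {f : R3 → ℝ} {g : Fin 3 → R3 → ℝ}
    (hf : IsScalarH1 Ω f g) (hfi : Integrable f) (hA : IsOpen A) (hA' : volume A ≠ ⊤) (w : R3)
    (hw : ∀ x ∈ A, ∀ t ∈ Set.Icc (0 : ℝ) 1, x + t • w ∈ Ω) :
    lpNorm (A.indicator fun x => f (x + w) - f x) 2 volume ≤ ‖w‖ * gradNorm g := by
  refine lpNorm_le_of_testFunction (F := A.indicator fun x => f (x + w) - f x) hA hA'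
    (((memLp_comp_add hf.memLp w).sub hf.memLp).indicator hA.measurableSet)
    (fun x hx => by simp [hx]) (mul_nonneg (norm_nonneg _) (gradNorm_nonneg _)) ?_
  intro φ hφ hφc hφA
  have hφm : MemLp φ 2 volume := hφ.continuous.memLp_of_hasCompactSupport hφc
  have h1 : ∫ x, φ x * A.indicator (fun x => f (x + w) - f x) x
      = ∫ x, φ x * (f (x + w) - f x) := by
    congr 1; ext x
    by_cases hx : x ∈ A
    · simp [hx]
    · simp [image_eq_zero_of_notMem_tsupport fun h => hx (hφA h)]
  rw [h1]
  have := abs_integral_mul_translate_sub_le hf hfi hφ hφc w (c := 0)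
    (M := ‖w‖ * gradNorm g * lpNorm φ 2 volume) (fun t ht x hx => hw x (hφA hx) t ht)
    (fun t _ => by
      have h2 := memLp_comp_add hφm (-(t • w))
      have h3 := lpNorm_comp_add hφm (-(t • w))
      simp only [← sub_eq_add_neg] at h2 h3
      have := abs_sum_mul_integral_le hf.memLp_deriv h2 w
      rw [h3] at this
      rw [sub_zero]
      linarith)
  simpa using this

end WeakDerivative

/-! ### Accessibility of Lipschitz domains by broken lines. -/

section Geometry

/-- The points from which the segment of direction `w` stays in `Ω`. -/
def segmentSet (Ω : Set R3) (w : R3) : Set R3 := {x | ∀ t ∈ Set.Icc (0 : ℝ) 1, x + t • w ∈ Ω}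

lemma isOpen_segmentSet {Ω : Set R3} (hΩ : IsOpen Ω) (w : R3) : IsOpen (segmentSet Ω w) := by
  rw [isOpen_iff_eventually]
  intro x hx
  refine isCompact_Icc.eventually_forall_of_forall_eventually fun t ht => ?_
  have hc : Continuous fun z : R3 × ℝ => z.1 + z.2 • w := by fun_prop
  exact hc.continuousAt.eventually_mem (hΩ.mem_nhds (hx t ht))

lemma segmentSet_subset (Ω : Set R3) (w : R3) : segmentSet Ω w ⊆ Ω := fun x hx => by
  simpa using hx 0 (by simp)

/-- The points `x` such that the broken line from `x` to `x + h`, which goes through `x + v` and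
`x + v + h`, is contained in `Ω`. -/
def brokenLineSet (Ω : Set R3) (v h : R3) : Set R3 :=
  {x | x ∈ segmentSet Ω v ∧ x + v ∈ segmentSet Ω h ∧ x + h ∈ segmentSet Ω v}

/-- `Ω` is locally accessible near `s`: neighbouring points of `Ω` in `s` are joined by broken lines
in `Ω` whose directions are taken in a finite set. -/
def LocallyAccessible (Ω s : Set R3) : Prop :=
  ∃ S : Finset R3, ∃ ρ > 0, ∀ y ∈ s, ∀ h : R3, ‖h‖ < ρ → y ∈ Ω → y + h ∈ Ω →
    ∃ U ∈ S, y ∈ brokenLineSet Ω (‖h‖ • U) h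

lemma locallyAccessible_interior {Ω : Set R3} (hΩ : IsOpen Ω) {x : R3} (hx : x ∈ Ω) :
    ∃ ρ > 0, LocallyAccessible Ω (Metric.ball x ρ) := by
  obtain ⟨r, hr, hrΩ⟩ := Metric.isOpen_iff.1 hΩ x hx
  -- With direction $0$ the broken line degenerates to the segment from $y$ to $y+h$, which lies in
  -- the ball of radius $r$.
  refine ⟨r / 2, half_pos hr, {0}, r / 2, half_pos hr, fun y hy h hh hyΩ hyhΩ => ⟨0, by simp, ?_⟩⟩
  refine ⟨fun t _ => by simpa using hyΩ, fun t ht => hrΩ ?_, fun t _ => by simpa using hyhΩ⟩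
  rw [mem_ball_iff_norm] at hy ⊢
  have h1 : y + ‖h‖ • (0 : R3) + t • h - x = (y - x) + t • h := by simp; abel
  rw [h1]
  have h2 : ‖t • h‖ ≤ ‖h‖ := by
    rw [norm_smul, Real.norm_of_nonneg ht.1]
    exact mul_le_of_le_one_left (norm_nonneg _) ht.2
  linarith [norm_add_le (y - x) (t • h)]

lemma norm_firstTwo_le (z : R3) : ‖!₂[z 0, z 1]‖ ≤ ‖z‖ := by
  rw [EuclideanSpace.norm_eq, EuclideanSpace.norm_eq]
  apply Real.sqrt_le_sqrt
  simp [Fin.sum_univ_two, Fin.sum_univ_three]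
  positivity

/-- A move $k=(k',k_3)$ changes the height of the graph by at most $L|k'|$. A point above the graph
therefore stays above it when $L|k'|\le k_3$, as long as the local description of $\Omega$ applies.
-/
lemma mem_of_mem_of_cone {Ω B : Set R3} {Φ : R3 ≃ₗᵢ[ℝ] R3} {γ : EuclideanSpace ℝ (Fin 2) → ℝ}
    {L : NNReal} (hγ : LipschitzWith L γ) (hB : ∀ x ∈ B, (x ∈ Ω ↔ γ !₂[Φ x 0, Φ x 1] < Φ x 2))
    {z k : R3} (hzB : z ∈ B) (hz : z ∈ Ω) (hkB : z + k ∈ B)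
    (hk : L * ‖!₂[Φ k 0, Φ k 1]‖ ≤ Φ k 2) : z + k ∈ Ω := by
  rw [hB _ hkB]
  rw [hB _ hzB] at hz
  have h1 := hγ.dist_le_mul !₂[Φ (z + k) 0, Φ (z + k) 1] !₂[Φ z 0, Φ z 1]
  have h2 : !₂[Φ (z + k) 0, Φ (z + k) 1] - !₂[Φ z 0, Φ z 1] = !₂[Φ k 0, Φ k 1] := by
    ext i
    fin_cases i <;> simp
  rw [dist_eq_norm _ (!₂[Φ z 0, Φ z 1]), h2, Real.dist_eq] at h1
  have h3 := (abs_le.1 (h1.trans hk)).2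
  have h4 : Φ (z + k) 2 = Φ z 2 + Φ k 2 := by simp
  linarith

/-- All three segments are translations by vectors of the upward cone, starting from $y$ or $y+h$.
With the upward vector $U$ of length $L+1$, the vector $\|h\|U+th$ rises by at least
$(L+1)\|h\|-\|h\|=L\|h\|$, which dominates $L$ times its horizontal part. -/
lemma locallyAccessible_frontier {Ω : Set R3} (hLip : HasLipschitzBoundary Ω) {p : R3}
    (hp : p ∈ frontier Ω) : ∃ ρ > 0, LocallyAccessible Ω (Metric.ball p ρ) := by
  obtain ⟨r, hr, Φ, γ, L, hγ, hB⟩ := hLip p hp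
  have hL0 : (0 : ℝ) ≤ L := L.2
  have hρ : 0 < r / (L + 3) := by positivity
  set U : R3 := ((L : ℝ) + 1) • Φ.symm (e 2) with hU
  have hUn : ‖U‖ = L + 1 := by
    rw [hU, norm_smul, LinearIsometryEquiv.norm_map, Real.norm_of_nonneg (by positivity)]
    simp [e]
  have hΦU : Φ U = ((L : ℝ) + 1) • e 2 := by simp [hU]
  -- The broken line stays within $\|y-p\|+\|h\|+(L+1)\|h\|<(L+3)\cdot\frac r{L+3}=r$ of $p$.
  refine ⟨r / (L + 3), hρ, {U}, r / (L + 3), hρ, fun y hy h hh hyΩ hyhΩ => ⟨U, by simp, ?_⟩⟩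
  rw [mem_ball_iff_norm] at hy
  have hsum : ‖y - p‖ + ‖h‖ + ‖h‖ * (L + 1) < r := by
    have h1 : ‖h‖ * (L + 1) ≤ r / (L + 3) * (L + 1) := by gcongr
    have h2 : r / (L + 3) + r / (L + 3) + r / (L + 3) * (L + 1) = r := by field_simp; ring
    linarith
  have hv : ∀ t ∈ Set.Icc (0 : ℝ) 1, ‖t • ‖h‖ • U‖ ≤ ‖h‖ * (L + 1) := fun t ht => by
    rw [norm_smul, norm_smul, hUn, Real.norm_of_nonneg ht.1, norm_norm]
    exact mul_le_of_le_one_left (by positivity) ht.2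
  have hth : ∀ t ∈ Set.Icc (0 : ℝ) 1, ‖t • h‖ ≤ ‖h‖ := fun t ht => by
    rw [norm_smul, Real.norm_of_nonneg ht.1]
    exact mul_le_of_le_one_left (norm_nonneg _) ht.2
  have hhpos := norm_nonneg h
  have hprod : 0 ≤ ‖h‖ * (L + 1) := by positivity
  have hyB : y ∈ Metric.ball p r := by
    rw [mem_ball_iff_norm]; linarith
  have hyhB : y + h ∈ Metric.ball p r := by
    rw [mem_ball_iff_norm, add_sub_right_comm]
    linarith [norm_add_le (y - p) h]
  have hup : ∀ t ∈ Set.Icc (0 : ℝ) 1,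
      L * ‖!₂[Φ (t • ‖h‖ • U) 0, Φ (t • ‖h‖ • U) 1]‖ ≤ Φ (t • ‖h‖ • U) 2 := fun t ht => by
    have h0 : (!₂[0, 0] : EuclideanSpace ℝ (Fin 2)) = 0 := by ext i; fin_cases i <;> rfl
    have := ht.1
    simp only [map_smul, hΦU, e]
    simp [h0]
    positivity
  refine ⟨fun t ht => ?_, fun t ht => ?_, fun t ht => ?_⟩
  · refine mem_of_mem_of_cone hγ hB hyB hyΩ ?_ (hup t ht)
    rw [mem_ball_iff_norm, add_sub_right_comm]
    linarith [norm_add_le (y - p) (t • ‖h‖ • U), hv t ht]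
  · rw [add_assoc]
    refine mem_of_mem_of_cone hγ hB hyB hyΩ ?_ ?_
    · rw [mem_ball_iff_norm, add_sub_right_comm, ← add_assoc]
      have := hv 1 (by simp)
      rw [one_smul] at this
      linarith [norm_add_le (y - p + ‖h‖ • U) (t • h), norm_add_le (y - p) (‖h‖ • U), hth t ht]
    · have e0 : Φ (‖h‖ • U + t • h) 0 = t * Φ h 0 := by
        simp [hΦU, e]
      have e1 : Φ (‖h‖ • U + t • h) 1 = t * Φ h 1 := by
        simp [hΦU, e]
      have e2 : Φ (‖h‖ • U + t • h) 2 = ‖h‖ * (L + 1) + t * Φ h 2 := by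
        simp [hΦU, e]
      have e3 : !₂[t * Φ h 0, t * Φ h 1] = t • !₂[Φ h 0, Φ h 1] := by
        ext i; fin_cases i <;> simp
      rw [e0, e1, e2, e3, norm_smul, Real.norm_of_nonneg ht.1]
      have b1 := norm_firstTwo_le (Φ h)
      have b2 := abs_le.1 (abs_apply_le_norm (Φ h) 2)
      rw [LinearIsometryEquiv.norm_map] at b1 b2
      have b3 : t * ‖!₂[Φ h 0, Φ h 1]‖ ≤ ‖h‖ :=
        (mul_le_of_le_one_left (norm_nonneg _) ht.2).trans b1
      have b4 := mul_le_mul_of_nonneg_left b3 hL0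
      have b5 : -‖h‖ ≤ t * Φ h 2 := by
        have := mul_le_mul_of_nonneg_left b2.1 ht.1
        have := mul_le_of_le_one_left hhpos ht.2
        linarith
      linarith
  · refine mem_of_mem_of_cone hγ hB hyhB hyhΩ ?_ (hup t ht)
    rw [mem_ball_iff_norm, add_sub_right_comm, add_sub_right_comm]
    linarith [norm_add_le (y - p + h) (t • ‖h‖ • U), norm_add_le (y - p) h, hv t ht]

lemma locallyAccessible_of_hasLipschitzBoundary {Ω : Set R3} (hΩ : IsOpen Ω)
    (hbdd : Bornology.IsBounded Ω) (hLip : HasLipschitzBoundary Ω) : LocallyAccessible Ω Ω := by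
  classical
  have hK : IsCompact (closure Ω) := hbdd.isCompact_closure
  suffices h : LocallyAccessible Ω (closure Ω) by
    obtain ⟨S, ρ, hρ, H⟩ := h
    exact ⟨S, ρ, hρ, fun y hy => H y (subset_closure hy)⟩
  -- Induction on the compact closure: accessibility is local, and for a union the direction sets
  -- are joined and the smaller $\rho$ is kept.
  refine hK.induction_on (p := LocallyAccessible Ω) ⟨∅, 1, one_pos, by simp⟩ ?_ ?_ ?_
  · rintro s t hst ⟨S, ρ, hρ, H⟩
    exact ⟨S, ρ, hρ, fun y hy => H y (hst hy)⟩
  · rintro s t ⟨S, ρ, hρ, H⟩ ⟨S', ρ', hρ', H'⟩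
    refine ⟨S ∪ S', min ρ ρ', lt_min hρ hρ', ?_⟩
    rintro y (hy | hy) h hh h1 h2
    · obtain ⟨U, hU, hU'⟩ := H y hy h (hh.trans_le (min_le_left _ _)) h1 h2
      exact ⟨U, Finset.mem_union_left _ hU, hU'⟩
    · obtain ⟨U, hU, hU'⟩ := H' y hy h (hh.trans_le (min_le_right _ _)) h1 h2
      exact ⟨U, Finset.mem_union_right _ hU, hU'⟩
  · intro x hx
    obtain ⟨ρ, hρ, H⟩ : ∃ ρ > 0, LocallyAccessible Ω (Metric.ball x ρ) := by
      by_cases hxΩ : x ∈ Ω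
      · exact locallyAccessible_interior hΩ hxΩ
      · exact locallyAccessible_frontier hLip ⟨hx, by rwa [hΩ.interior_eq]⟩
    exact ⟨_, mem_nhdsWithin_of_mem_nhds (Metric.ball_mem_nhds x hρ), H⟩

end Geometry

/-! ### The $L^2$ bound on increments of $H^1$ functions. -/

section DifferenceQuotient

/-- On the set, $f(x+h)-f(x)$ is the increment by $v$ at $x$, plus that by $h$ at $x+v$, minus that
by $v$ at $x+h$. Each runs along a segment in $\Omega$, and translation does not change its norm. -/
lemma lpNorm_indicator_brokenLine_le {Ω : Set R3} {f : R3 → ℝ} {g : Fin 3 → R3 → ℝ}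
    (hf : IsScalarH1 Ω f g) (hΩ : IsOpen Ω) (hΩ' : volume Ω ≠ ⊤) (v h : R3) :
    lpNorm ((brokenLineSet Ω v h).indicator fun x => f (x + h) - f x) 2 volume ≤
      (2 * ‖v‖ + ‖h‖) * gradNorm g := by
  have hfi := hf.integrable hΩ.measurableSet hΩ'
  have hfin : ∀ w, volume (segmentSet Ω w) ≠ ⊤ := fun w =>
    ne_top_of_le_ne_top hΩ' (measure_mono (segmentSet_subset Ω w))
  set F : R3 → R3 → ℝ := fun w => (segmentSet Ω w).indicator fun x => f (x + w) - f x with hF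
  have hFm : ∀ w, MemLp (F w) 2 volume := fun w =>
    ((memLp_comp_add hf.memLp w).sub hf.memLp).indicator (isOpen_segmentSet hΩ w).measurableSet
  have hFn : ∀ w, lpNorm (F w) 2 volume ≤ ‖w‖ * gradNorm g := fun w =>
    lpNorm_indicator_translate_sub_le hf hfi (isOpen_segmentSet hΩ w) (hfin w) w fun x hx => hx
  have m1 := hFm v
  have m2 := memLp_comp_add (hFm h) v
  have m3 := memLp_comp_add (hFm v) h
  have n2 := lpNorm_comp_add (hFm h) v
  have n3 := lpNorm_comp_add (hFm v) h
  set G : R3 → ℝ := (F v + fun x => F h (x + v)) - fun x => F v (x + h) with hG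
  have hle : lpNorm ((brokenLineSet Ω v h).indicator fun x => f (x + h) - f x) 2 volume ≤
      lpNorm G 2 volume := by
    refine lpNorm_mono_ae ((m1.add m2).sub m3) (Eventually.of_forall fun x => ?_)
    by_cases hx : x ∈ brokenLineSet Ω v h
    · have hGx : G x = f (x + h) - f x := by
        simp only [hG, hF, Pi.sub_apply, Pi.add_apply, Set.indicator_of_mem hx.1,
          Set.indicator_of_mem hx.2.1, Set.indicator_of_mem hx.2.2]
        rw [add_right_comm x v h]; ring
      rw [Set.indicator_of_mem hx, hGx]
    · simp [hx]
  have h1 : lpNorm G 2 volume ≤ lpNorm (F v + fun x => F h (x + v)) 2 volume +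
      lpNorm (fun x => F v (x + h)) 2 volume := lpNorm_sub_le (m1.add m2) (by norm_num)
  have h2 : lpNorm (F v + fun x => F h (x + v)) 2 volume ≤ lpNorm (F v) 2 volume +
      lpNorm (fun x => F h (x + v)) 2 volume := lpNorm_add_le m1 (by norm_num)
  rw [n3] at h1
  rw [n2] at h2
  linarith [hFn v, hFn h]

/-- The pairs `(x, x + h)` in `Ω × Ω`, viewed from `x`. -/
def overlap (Ω : Set R3) (h : R3) : Set R3 := {x | x ∈ Ω ∧ x + h ∈ Ω}

lemma measurableSet_overlap {Ω : Set R3} (hΩ : MeasurableSet Ω) (h : R3) :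
    MeasurableSet (overlap Ω h) :=
  hΩ.inter (measurable_add_const h hΩ)

/-- The increment of `f` by a translation, where it makes sense in `Ω`. -/
noncomputable def increment (Ω : Set R3) (f : R3 → ℝ) (h : R3) : R3 → ℝ :=
  (overlap Ω h).indicator fun x => f (x + h) - f x

lemma memLp_increment {Ω : Set R3} (hΩ : MeasurableSet Ω) {f : R3 → ℝ} (hf : MemLp f 2 volume)
    (h : R3) : MemLp (increment Ω f h) 2 volume :=
  ((memLp_comp_add hf h).sub hf).indicator (measurableSet_overlap hΩ h)

/-- On a bounded Lipschitz domain, the increments of `H¹` functions are of the order of the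
translation. -/
theorem exists_lpNorm_increment_le {Ω : Set R3} (hΩ : IsOpen Ω) (hbdd : Bornology.IsBounded Ω)
    (hLip : HasLipschitzBoundary Ω) :
    ∃ C ≥ 0, ∀ (f : R3 → ℝ) (g : Fin 3 → R3 → ℝ), IsScalarH1 Ω f g → ∀ h : R3,
      lpNorm (increment Ω f h) 2 volume ≤ C * ‖h‖ * (lpNorm f 2 volume + gradNorm g) := by
  obtain ⟨S, ρ, hρ, H⟩ := locallyAccessible_of_hasLipschitzBoundary hΩ hbdd hLip
  have hΩ' : volume Ω ≠ ⊤ := hbdd.measure_lt_top.ne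
  have hS : 0 ≤ ∑ U ∈ S, (2 * ‖U‖ + 1) := Finset.sum_nonneg fun U _ => by positivity
  -- The sum serves short translations, where some broken line with $U\in S$ is available. The term
  -- $2/\rho$ serves $\|h\|\ge\rho$, where the trivial bound $2\|f\|$ is at most
  -- $(2/\rho)\|h\|\|f\|$.
  refine ⟨∑ U ∈ S, (2 * ‖U‖ + 1) + 2 / ρ, by positivity, fun f g hf h => ?_⟩
  have hg0 := gradNorm_nonneg g
  have hf0 : 0 ≤ lpNorm f 2 volume := lpNorm_nonneg
  have hm := (memLp_comp_add hf.memLp h).sub hf.memLp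
  rcases lt_or_ge ‖h‖ ρ with hh | hh
  · set F : R3 → R3 → ℝ := fun U x =>
      |(brokenLineSet Ω (‖h‖ • U) h).indicator (fun x => f (x + h) - f x) x| with hF
    have hmeas : ∀ U, MeasurableSet (brokenLineSet Ω (‖h‖ • U) h) := fun U =>
      ((isOpen_segmentSet hΩ _).inter (((isOpen_segmentSet hΩ _).preimage (continuous_add_const _)).inter
        ((isOpen_segmentSet hΩ _).preimage (continuous_add_const _)))).measurableSet
    have hFm : ∀ U, MemLp (F U) 2 volume := fun U => (hm.indicator (hmeas U)).abs
    have h1 : lpNorm (increment Ω f h) 2 volume ≤ lpNorm (∑ U ∈ S, F U) 2 volume := by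
      refine lpNorm_mono_ae (memLp_finsetSum' _ fun U _ => hFm U) (Eventually.of_forall fun x => ?_)
      refine le_trans ?_ (le_abs_self _)
      rw [Finset.sum_apply]
      by_cases hx : x ∈ overlap Ω h
      · obtain ⟨U, hU, hxU⟩ := H x hx.1 h hh hx.1 hx.2
        refine le_trans (le_of_eq ?_) (Finset.single_le_sum (f := fun U => F U x)
          (fun U _ => abs_nonneg _) hU)
        simp [hF, increment, hx, hxU]
      · simp only [increment, Set.indicator_of_notMem hx, abs_zero]
        exact Finset.sum_nonneg fun U _ => abs_nonneg _
    have h2 : ∀ U, lpNorm (F U) 2 volume ≤ (2 * ‖U‖ + 1) * (‖h‖ * gradNorm g) := fun U => by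
      have := lpNorm_indicator_brokenLine_le hf hΩ hΩ' (‖h‖ • U) h
      rw [norm_smul, norm_norm] at this
      refine (lpNorm_fun_abs (f := (brokenLineSet Ω (‖h‖ • U) h).indicator fun x => f (x + h) - f x)
        (hm.indicator (hmeas U)).1 2).le.trans (this.trans (le_of_eq (by ring)))
    have h3 : lpNorm (∑ U ∈ S, F U) 2 volume ≤ (∑ U ∈ S, (2 * ‖U‖ + 1)) * (‖h‖ * gradNorm g) := by
      rw [Finset.sum_mul]
      exact (lpNorm_sum_le (fun U _ => hFm U) (by norm_num)).trans (Finset.sum_le_sum fun U _ => h2 U)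
    refine (h1.trans h3).trans ?_
    rw [mul_assoc]
    gcongr
    · have : 0 ≤ 2 / ρ := by positivity
      linarith
    · linarith
  · have h1 : lpNorm (increment Ω f h) 2 volume ≤ lpNorm ((fun x => f (x + h)) - f) 2 volume := by
      refine lpNorm_mono_ae hm (Eventually.of_forall fun x => ?_)
      by_cases hx : x ∈ overlap Ω h
      · simp [increment, hx]
      · simp [increment, hx]
    have h2 : lpNorm ((fun x => f (x + h)) - f) 2 volume ≤ 2 * lpNorm f 2 volume := by
      have := lpNorm_sub_le (g := f) (memLp_comp_add hf.memLp h) (p := 2) (by norm_num)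
      rw [lpNorm_comp_add hf.memLp] at this
      linarith
    refine (h1.trans h2).trans ?_
    generalize ∑ U ∈ S, (2 * ‖U‖ + 1) = c at hS
    have h4 : 2 ≤ 2 / ρ * ‖h‖ := by
      rw [div_mul_eq_mul_div, le_div_iff₀ hρ]; linarith
    have h5 : 0 ≤ c * ‖h‖ := mul_nonneg hS (norm_nonneg h)
    refine mul_le_mul ?_ ?_ hf0 ?_ <;> linarith

end DifferenceQuotient

/-! ### First-order expansion of increments, tested against $L^2$ functions. -/

section Increment

/-- The increments of `H¹(Ω)` functions are of the order of the translation, with constant `C`. -/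
def IncrementBound (Ω : Set R3) (C : ℝ) : Prop :=
  ∀ (f : R3 → ℝ) (g : Fin 3 → R3 → ℝ), IsScalarH1 Ω f g → ∀ h : R3,
    lpNorm (increment Ω f h) 2 volume ≤ C * ‖h‖ * (lpNorm f 2 volume + gradNorm g)

/-- A test function is Lipschitz, and for $\|k\|\le1$ the difference vanishes off the compact
1-neighbourhood of its support. -/
lemma exists_lpNorm_translate_sub_le {φ : R3 → ℝ}
    (hφ : ContDiff ℝ ((⊤ : ℕ∞) : WithTop ℕ∞) φ) (hφc : HasCompactSupport φ) :
    ∃ D ≥ 0, ∀ k : R3, ‖k‖ ≤ 1 → lpNorm (fun x => φ (x - k) - φ x) 2 volume ≤ D * ‖k‖ := by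
  obtain ⟨L, hL⟩ := hφ.lipschitzWith_of_hasCompactSupport hφc (by simp)
  set K' := Metric.cthickening 1 (tsupport φ) with hK'
  have hK'c : IsCompact K' := hφc.isCompact.cthickening
  have hV : MemLp (K'.indicator fun _ => (1 : ℝ)) 2 volume :=
    memLp_indicator_const 2 hK'c.measurableSet 1 (Or.inr hK'c.measure_lt_top.ne)
  refine ⟨L * lpNorm (K'.indicator fun _ => (1 : ℝ)) 2 volume,
    mul_nonneg L.2 lpNorm_nonneg, fun k hk => ?_⟩
  have h1 := lpNorm_const_smul (p := 2) ((L : ℝ) * ‖k‖) (K'.indicator fun _ => (1 : ℝ))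
    (volume : Measure R3)
  have hLk : 0 ≤ (L : ℝ) * ‖k‖ := by positivity
  simp only [coe_nnnorm, Real.norm_of_nonneg hLk] at h1
  rw [mul_right_comm, ← h1]
  refine lpNorm_mono_ae (hV.const_smul _) (Eventually.of_forall fun x => ?_)
  by_cases hx : x ∈ K'
  · have := hL.dist_le_mul (x - k) x
    rw [Real.dist_eq, dist_eq_norm, sub_sub_cancel_left, norm_neg] at this
    simpa [hx, abs_of_nonneg hLk] using this
  · have hx1 : φ x = 0 := image_eq_zero_of_notMem_tsupport fun h =>
      hx (Metric.self_subset_cthickening _ h)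
    have hx2 : φ (x - k) = 0 := image_eq_zero_of_notMem_tsupport fun h =>
      hx (Metric.mem_cthickening_of_dist_le x (x - k) _ _ h (by
        rwa [dist_eq_norm, sub_sub_cancel]))
    simp only [hx1, hx2, sub_self, abs_zero]
    positivity

/-- The weak gradient is the first-order part of the increments, tested against `L²` functions. -/
theorem exists_abs_integral_mul_increment_sub_le {Ω : Set R3} (hΩ : IsOpen Ω)
    (hΩ' : volume Ω ≠ ⊤) {C : ℝ} (hC0 : 0 ≤ C) (hC : IncrementBound Ω C) {f : R3 → ℝ}
    {g : Fin 3 → R3 → ℝ} (hf : IsScalarH1 Ω f g) {u : R3 → ℝ} (hu : MemLp u 2 volume)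
    (hu0 : ∀ x ∉ Ω, u x = 0) {η : ℝ} (hη : 0 < η) :
    ∃ δ > 0, ∀ h : R3, ‖h‖ < δ →
      |(∫ x, u x * increment Ω f h x) - ∑ i, h i * ∫ x, u x * g i x| ≤ η * ‖h‖ := by
  set N := lpNorm f 2 volume + gradNorm g with hN
  have hN0 : 0 ≤ N := add_nonneg lpNorm_nonneg (gradNorm_nonneg g)
  have hgN : gradNorm g ≤ N := le_add_of_nonneg_left lpNorm_nonneg
  have hfi := hf.integrable hΩ.measurableSet hΩ'
  -- Replacing $u$ by a test function $\varphi$ costs $\eta'CN\|h\|$ in the increment term and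
  -- $\eta'N\|h\|$ in the gradient term; this choice keeps the total below $\frac\eta2\|h\|$.
  set η' := η / (2 * (C * N + N + 1)) with hη'
  have hη'0 : 0 < η' := by positivity
  obtain ⟨φ, hφ, hφc, hφΩ, hφu⟩ := exists_testFunction_lpNorm_sub_le hΩ hΩ' hu hu0 hη'0
  have hφm : MemLp φ 2 volume := hφ.continuous.memLp_of_hasCompactSupport hφc
  obtain ⟨D, hD0, hD⟩ := exists_lpNorm_translate_sub_le hφ hφc
  obtain ⟨δ, hδ, hδΩ⟩ := hφc.isCompact.exists_cthickening_subset_open hΩ hφΩ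
  -- The three bounds on $\|h\|$ respectively keep the translated support of $\varphi$ in $\Omega$,
  -- permit the Lipschitz estimate for $\varphi$, and give $DN\|h\|\le\eta/2$.
  refine ⟨min (min δ 1) (η / (2 * (D * N + 1))), by positivity, fun h hh => ?_⟩
  have hhδ : ‖h‖ ≤ δ := (hh.le.trans (min_le_left _ _)).trans (min_le_left _ _)
  have hh1 : ‖h‖ ≤ 1 := (hh.le.trans (min_le_left _ _)).trans (min_le_right _ _)
  have hhη : D * N * ‖h‖ ≤ η / 2 := by
    have h1 : ‖h‖ ≤ η / (2 * (D * N + 1)) := hh.le.trans (min_le_right _ _)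
    rw [le_div_iff₀ (by positivity)] at h1
    nlinarith [norm_nonneg h]
  have hinc := memLp_increment hΩ.measurableSet hf.memLp h
  have hth : ∀ t ∈ Set.Icc (0 : ℝ) 1, ‖t • h‖ ≤ ‖h‖ := fun t ht => by
    rw [norm_smul, Real.norm_of_nonneg ht.1]
    exact mul_le_of_le_one_left (norm_nonneg _) ht.2
  have hseg : ∀ t ∈ Set.Icc (0 : ℝ) 1, ∀ x ∈ tsupport φ, x + t • h ∈ Ω := fun t ht x hx =>
    hδΩ (Metric.mem_cthickening_of_dist_le _ x _ _ hx (by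
      rw [dist_eq_norm, add_sub_cancel_left]
      exact (hth t ht).trans hhδ))
  have e1 : ∫ x, φ x * increment Ω f h x = ∫ x, φ x * (f (x + h) - f x) := by
    congr 1; ext x
    by_cases hx : x ∈ tsupport φ
    · have : x ∈ overlap Ω h := ⟨hφΩ hx, by simpa using hseg 1 (by simp) x hx⟩
      simp [increment, this]
    · simp [image_eq_zero_of_notMem_tsupport hx]
  have b1 : |(∫ x, φ x * increment Ω f h x) - ∑ i, h i * ∫ x, φ x * g i x| ≤ η / 2 * ‖h‖ := by
    rw [e1]
    refine abs_integral_mul_translate_sub_le hf hfi hφ hφc h hseg fun t ht => ?_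
    have m1 : MemLp (fun x => φ (x - t • h)) 2 volume := by
      simpa only [← sub_eq_add_neg] using memLp_comp_add hφm (-(t • h))
    have m2 : MemLp (fun x => φ (x - t • h) - φ x) 2 volume := m1.sub hφm
    have e2 : (∑ i, h i * ∫ x, φ (x - t • h) * g i x) - ∑ i, h i * ∫ x, φ x * g i x =
        ∑ i, h i * ∫ x, (φ (x - t • h) - φ x) * g i x := by
      rw [← Finset.sum_sub_distrib]
      refine Finset.sum_congr rfl fun i _ => ?_
      rw [← mul_sub, ← integral_sub (integrable_mul_of_memLp_two m1 (hf.memLp_deriv i))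
        (integrable_mul_of_memLp_two hφm (hf.memLp_deriv i))]
      simp only [sub_mul]
    rw [e2]
    refine (abs_sum_mul_integral_le hf.memLp_deriv m2 h).trans ?_
    have h3 : lpNorm (fun x => φ (x - t • h) - φ x) 2 volume ≤ D * ‖h‖ :=
      (hD _ ((hth t ht).trans hh1)).trans (mul_le_mul_of_nonneg_left (hth t ht) hD0)
    calc ‖h‖ * lpNorm (fun x => φ (x - t • h) - φ x) 2 volume * gradNorm g
        ≤ ‖h‖ * (D * ‖h‖) * N := by
          have := gradNorm_nonneg g
          gcongr
      _ = (D * N * ‖h‖) * ‖h‖ := by ring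
      _ ≤ η / 2 * ‖h‖ := by gcongr
  have huφ := hu.sub hφm
  have b2 : |∫ x, (u - φ) x * increment Ω f h x| ≤ η' * (C * ‖h‖ * N) :=
    (abs_integral_mul_le huφ hinc).trans
      (mul_le_mul hφu (hC f g hf h) lpNorm_nonneg hη'0.le)
  have b3 : |∑ i, h i * ∫ x, (u - φ) x * g i x| ≤ ‖h‖ * η' * N := by
    refine (abs_sum_mul_integral_le hf.memLp_deriv huφ h).trans ?_
    have := gradNorm_nonneg g
    gcongr
  have e3 : ∫ x, u x * increment Ω f h x =
      (∫ x, φ x * increment Ω f h x) + ∫ x, (u - φ) x * increment Ω f h x := by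
    rw [← integral_add (integrable_mul_of_memLp_two hφm hinc)
      (integrable_mul_of_memLp_two huφ hinc)]
    congr 1; ext x; simp; ring
  have e4 : ∑ i, h i * ∫ x, u x * g i x =
      (∑ i, h i * ∫ x, φ x * g i x) + ∑ i, h i * ∫ x, (u - φ) x * g i x := by
    rw [← Finset.sum_add_distrib]
    refine Finset.sum_congr rfl fun i _ => ?_
    rw [← mul_add, ← integral_add (integrable_mul_of_memLp_two hφm (hf.memLp_deriv i))
      (integrable_mul_of_memLp_two huφ (hf.memLp_deriv i))]
    congr 2; ext x; simp; ring
  have b4 : η' * (C * N + N) ≤ η / 2 := by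
    rw [hη', div_mul_eq_mul_div, div_le_iff₀ (by positivity)]
    nlinarith
  have b5 := mul_le_mul_of_nonneg_right b4 (norm_nonneg h)
  rw [e3, e4]
  rw [abs_le] at *
  constructor <;> nlinarith

end Increment

/-! ### The scalar nonlocal form: representation, uniform bound and limit. -/

section BilinearForm

/-- The integrand of the scalar nonlocal form with kernel `κ`. -/
noncomputable def formIntegrand (κ u f : R3 → ℝ) (p : R3 × R3) : ℝ :=
  ‖p.1 - p.2‖⁻¹ * κ (p.1 - p.2) * (u p.2 * (f p.1 - f p.2))

/-- The scalar nonlocal form with kernel `κ`. -/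
noncomputable def nonlocalForm (Ω : Set R3) (κ u f : R3 → ℝ) : ℝ :=
  ∫ p in Ω ×ˢ Ω, formIntegrand κ u f p

/-- The mean difference quotient of `f` in the direction `h`, weighted by `u`. -/
noncomputable def meanQuotient (Ω : Set R3) (u f : R3 → ℝ) (h : R3) : ℝ :=
  ‖h‖⁻¹ * ∫ x, u x * increment Ω f h x

variable {Ω : Set R3} {C : ℝ} {κ u f : R3 → ℝ} {g : Fin 3 → R3 → ℝ}

lemma inv_norm_mul_integral_le (hC0 : 0 ≤ C) (hC : IncrementBound Ω C) (hΩ : IsOpen Ω)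
    (hf : IsScalarH1 Ω f g) (hu : MemLp u 2 volume) (h : R3) :
    ‖h‖⁻¹ * ∫ x, |u x * increment Ω f h x| ≤
      C * lpNorm u 2 volume * (lpNorm f 2 volume + gradNorm g) := by
  have hN0 : 0 ≤ lpNorm f 2 volume + gradNorm g := add_nonneg lpNorm_nonneg (gradNorm_nonneg g)
  have h1 := (integral_abs_mul_le hu (memLp_increment hΩ.measurableSet hf.memLp h)).trans
    (mul_le_mul_of_nonneg_left (hC f g hf h) lpNorm_nonneg)
  refine (mul_le_mul_of_nonneg_left h1 (inv_nonneg.2 (norm_nonneg h))).trans ?_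
  -- Only an inequality, because the product is $0$ at $h=0$ by the convention $0^{-1}=0$.
  have h2 : ‖h‖⁻¹ * ‖h‖ ≤ 1 := inv_mul_le_one
  have h3 : 0 ≤ C * lpNorm u 2 volume * (lpNorm f 2 volume + gradNorm g) :=
    mul_nonneg (mul_nonneg hC0 lpNorm_nonneg) hN0
  calc _ = ‖h‖⁻¹ * ‖h‖ * (C * lpNorm u 2 volume * (lpNorm f 2 volume + gradNorm g)) := by ring
    _ ≤ _ := mul_le_of_le_one_left h3 h2

lemma abs_meanQuotient_le (hC0 : 0 ≤ C) (hC : IncrementBound Ω C) (hΩ : IsOpen Ω)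
    (hf : IsScalarH1 Ω f g) (hu : MemLp u 2 volume) (h : R3) :
    |meanQuotient Ω u f h| ≤ C * lpNorm u 2 volume * (lpNorm f 2 volume + gradNorm g) := by
  refine le_trans ?_ (inv_norm_mul_integral_le hC0 hC hΩ hf hu h)
  rw [meanQuotient, abs_mul, abs_of_nonneg (inv_nonneg.2 (norm_nonneg h))]
  gcongr
  exact abs_integral_le_integral_abs

lemma aestronglyMeasurable_formIntegrand (hκ : Integrable κ) (hu : MemLp u 2 volume)
    (hf : MemLp f 2 volume) :
    AEStronglyMeasurable (formIntegrand κ u f) ((volume : Measure R3).prod volume) := by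
  have h1 : AEStronglyMeasurable (fun p : R3 × R3 => κ (p.1 - p.2))
      ((volume : Measure R3).prod volume) :=
    hκ.1.comp_quasiMeasurePreserving (quasiMeasurePreserving_sub volume volume)
  have h2 : AEStronglyMeasurable (fun p : R3 × R3 => ‖p.1 - p.2‖⁻¹)
      ((volume : Measure R3).prod volume) :=
    (measurable_fst.sub measurable_snd).norm.inv.aestronglyMeasurable
  exact (h2.mul h1).mul (hu.1.comp_snd.mul (hf.1.comp_fst.sub hf.1.comp_snd))

/-- Tonelli: for fixed $h$ the factor $\|h\|^{-1}$ is absorbed by the increment bound, leaving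
$|\kappa(h)|$ times a constant. -/
lemma integrable_shear (hC0 : 0 ≤ C) (hC : IncrementBound Ω C) (hΩ : IsOpen Ω)
    (hκ : Integrable κ) (hf : IsScalarH1 Ω f g) (hu : MemLp u 2 volume)
    (hm : AEStronglyMeasurable (fun q : R3 × R3 => ‖q.1‖⁻¹ * κ q.1 *
      (u q.2 * increment Ω f q.1 q.2)) ((volume : Measure R3).prod volume)) :
    Integrable (fun q : R3 × R3 => ‖q.1‖⁻¹ * κ q.1 * (u q.2 * increment Ω f q.1 q.2))
      ((volume : Measure R3).prod volume) := by
  rw [integrable_prod_iff hm]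
  refine ⟨Eventually.of_forall fun h => (integrable_mul_of_memLp_two hu
    (memLp_increment hΩ.measurableSet hf.memLp h)).const_mul (‖h‖⁻¹ * κ h), ?_⟩
  refine (hκ.norm.mul_const (C * lpNorm u 2 volume * (lpNorm f 2 volume + gradNorm g))).mono'
    hm.norm.integral_prod_right' (Eventually.of_forall fun h => ?_)
  have e1 : ∫ y, ‖‖h‖⁻¹ * κ h * (u y * increment Ω f h y)‖ =
      ‖κ h‖ * (‖h‖⁻¹ * ∫ y, |u y * increment Ω f h y|) := by
    simp only [norm_mul (‖h‖⁻¹ * κ h), integral_const_mul, Real.norm_eq_abs]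
    rw [abs_mul, abs_of_nonneg (inv_nonneg.2 (norm_nonneg h))]
    ring
  rw [Real.norm_of_nonneg (integral_nonneg fun y => norm_nonneg _), e1]
  exact mul_le_mul_of_nonneg_left (inv_norm_mul_integral_le hC0 hC hΩ hf hu h) (norm_nonneg _)

/-- Under the measure-preserving shear $(h,y)\mapsto(h+y,y)$ the kernel depends on $h$ alone, and
the domain $\Omega\times\Omega$ becomes the overlap condition in `increment`. -/
lemma indicator_formIntegrand_shear (κ u f : R3 → ℝ) (q : R3 × R3) :
    (Ω ×ˢ Ω).indicator (formIntegrand κ u f) (q.1 + q.2, q.2) =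
      ‖q.1‖⁻¹ * κ q.1 * (u q.2 * increment Ω f q.1 q.2) := by
  by_cases hq : q.2 ∈ overlap Ω q.1
  · have : (q.1 + q.2, q.2) ∈ Ω ×ˢ Ω := ⟨by simpa only [add_comm] using hq.2, hq.1⟩
    rw [Set.indicator_of_mem this, increment, Set.indicator_of_mem hq]
    simp [formIntegrand, add_comm]
  · have : (q.1 + q.2, q.2) ∉ Ω ×ˢ Ω := fun h => hq ⟨h.2, by simpa only [add_comm] using h.1⟩
    rw [Set.indicator_of_notMem this, increment, Set.indicator_of_notMem hq]
    simp

lemma integrable_shear_of_isScalarH1 (hC0 : 0 ≤ C) (hC : IncrementBound Ω C) (hΩ : IsOpen Ω)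
    (hκ : Integrable κ) (hf : IsScalarH1 Ω f g) (hu : MemLp u 2 volume) :
    Integrable (fun q : R3 × R3 => ‖q.1‖⁻¹ * κ q.1 * (u q.2 * increment Ω f q.1 q.2))
      ((volume : Measure R3).prod volume) := by
  have hm := ((aestronglyMeasurable_formIntegrand hκ hu hf.memLp).indicator
    (hΩ.measurableSet.prod hΩ.measurableSet)).comp_measurePreserving
    (measurePreserving_add_prod (volume : Measure R3) volume)
  exact integrable_shear hC0 hC hΩ hκ hf hu
    (hm.congr (Eventually.of_forall (indicator_formIntegrand_shear κ u f)))

lemma integrableOn_formIntegrand (hC0 : 0 ≤ C) (hC : IncrementBound Ω C) (hΩ : IsOpen Ω)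
    (hκ : Integrable κ) (hf : IsScalarH1 Ω f g) (hu : MemLp u 2 volume) :
    IntegrableOn (formIntegrand κ u f) (Ω ×ˢ Ω) := by
  have hm := (aestronglyMeasurable_formIntegrand hκ hu hf.memLp).indicator
    (hΩ.measurableSet.prod hΩ.measurableSet)
  rw [← integrable_indicator_iff (hΩ.measurableSet.prod hΩ.measurableSet), Measure.volume_eq_prod,
    ← (measurePreserving_add_prod (volume : Measure R3) volume).integrable_comp hm]
  exact (integrable_shear_of_isScalarH1 hC0 hC hΩ hκ hf hu).congr
    (Eventually.of_forall fun q => (indicator_formIntegrand_shear κ u f q).symm)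

lemma nonlocalForm_eq (hC0 : 0 ≤ C) (hC : IncrementBound Ω C) (hΩ : IsOpen Ω)
    (hκ : Integrable κ) (hf : IsScalarH1 Ω f g) (hu : MemLp u 2 volume) :
    Integrable (fun h => κ h * meanQuotient Ω u f h) ∧
      nonlocalForm Ω κ u f = ∫ h, κ h * meanQuotient Ω u f h := by
  have hi := integrable_shear_of_isScalarH1 hC0 hC hΩ hκ hf hu
  have e1 : ∀ h, ∫ y, ‖h‖⁻¹ * κ h * (u y * increment Ω f h y) = κ h * meanQuotient Ω u f h := by
    intro h
    rw [integral_const_mul, meanQuotient]; ring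
  refine ⟨hi.integral_prod_left.congr (Eventually.of_forall e1), ?_⟩
  have hm := (aestronglyMeasurable_formIntegrand hκ hu hf.memLp).indicator
    (hΩ.measurableSet.prod hΩ.measurableSet)
  have hT := measurePreserving_add_prod (volume : Measure R3) volume
  rw [nonlocalForm, ← integral_indicator (hΩ.measurableSet.prod hΩ.measurableSet),
    Measure.volume_eq_prod, ← hT.map_eq, integral_map hT.aemeasurable (by rwa [hT.map_eq])]
  simp only [indicator_formIntegrand_shear]
  rw [integral_prod _ hi]
  simp only [e1]

/-- The bound sees the kernel only through its mass, so it is uniform in $\varepsilon$; this permits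
$u$ and $f$ to vary with $\varepsilon$. -/
lemma abs_nonlocalForm_le (hC0 : 0 ≤ C) (hC : IncrementBound Ω C) (hΩ : IsOpen Ω)
    (hκ : Integrable κ) (hκ1 : ∫ h, |κ h| ≤ 1) (hf : IsScalarH1 Ω f g) (hu : MemLp u 2 volume) :
    |nonlocalForm Ω κ u f| ≤ C * lpNorm u 2 volume * (lpNorm f 2 volume + gradNorm g) := by
  obtain ⟨h1, h2⟩ := nonlocalForm_eq hC0 hC hΩ hκ hf hu
  have hM : 0 ≤ C * lpNorm u 2 volume * (lpNorm f 2 volume + gradNorm g) :=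
    mul_nonneg (mul_nonneg hC0 lpNorm_nonneg) (add_nonneg lpNorm_nonneg (gradNorm_nonneg g))
  rw [h2]
  refine abs_integral_le_integral_abs.trans ?_
  refine (integral_mono h1.abs (hκ.abs.mul_const _) fun h => ?_).trans
    ((integral_mul_const _ _).le.trans (mul_le_of_le_one_left hM hκ1))
  simp only [abs_mul (κ h)]
  exact mul_le_mul_of_nonneg_left (abs_meanQuotient_le hC0 hC hΩ hf hu h) (abs_nonneg _)

lemma abs_div_norm_le (h : R3) (i : Fin 3) : |h i / ‖h‖| ≤ 1 := by
  rw [abs_div, abs_norm]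
  exact div_le_one_of_le₀ (abs_apply_le_norm h i) (norm_nonneg h)

lemma integrable_div_norm_mul (hκ : Integrable κ) (i : Fin 3) :
    Integrable fun h : R3 => h i / ‖h‖ * κ h :=
  hκ.bdd_mul (c := 1) (by
    have : Measurable fun h : R3 => h i / ‖h‖ := by fun_prop
    exact this.aestronglyMeasurable) (Eventually.of_forall fun h => abs_div_norm_le h i)

/-- Convergence of the scalar nonlocal forms for concentrating kernels. -/
theorem tendsto_nonlocalForm {ι : Type*} {l : Filter ι} (hC0 : 0 ≤ C) (hC : IncrementBound Ω C)
    (hΩ : IsOpen Ω) (hΩ' : volume Ω ≠ ⊤) {κ : ι → R3 → ℝ} {d : Fin 3 → ℝ}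
    (hκ : ∀ᶠ ε in l, Integrable (κ ε) ∧ ∫ h, |κ ε h| ≤ 1)
    (hconc : ∀ δ > 0, Tendsto (fun ε => ∫ y in (Metric.ball (0 : R3) δ)ᶜ, |κ ε y|) l (𝓝 0))
    (hd : ∀ i, Tendsto (fun ε => ∫ y : R3, y i / ‖y‖ * κ ε y) l (𝓝 (d i)))
    (hf : IsScalarH1 Ω f g) (hu : MemLp u 2 volume) (hu0 : ∀ x ∉ Ω, u x = 0) :
    Tendsto (fun ε => nonlocalForm Ω (κ ε) u f) l (𝓝 (∑ i, d i * ∫ x, u x * g i x)) := by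
  set c : Fin 3 → ℝ := fun i => ∫ x, u x * g i x with hc
  set M := C * lpNorm u 2 volume * (lpNorm f 2 volume + gradNorm g) + ∑ i, |c i| with hM
  have hM0 : 0 ≤ M := add_nonneg (mul_nonneg (mul_nonneg hC0 lpNorm_nonneg)
    (add_nonneg lpNorm_nonneg (gradNorm_nonneg g))) (Finset.sum_nonneg fun _ _ => abs_nonneg _)
  have hlim : Tendsto (fun ε => ∑ i, (∫ y : R3, y i / ‖y‖ * κ ε y) * c i) l
      (𝓝 (∑ i, d i * c i)) := tendsto_finsetSum _ fun i _ => (hd i).mul_const _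
  suffices h0 : Tendsto (fun ε => nonlocalForm Ω (κ ε) u f -
      ∑ i, (∫ y : R3, y i / ‖y‖ * κ ε y) * c i) l (𝓝 0) by
    simpa using h0.add hlim
  rw [Metric.tendsto_nhds]
  intro η hη
  obtain ⟨δ, hδ, hδ'⟩ := exists_abs_integral_mul_increment_sub_le hΩ hΩ' hC0 hC hf hu hu0
    (half_pos hη)
  have hev : ∀ᶠ ε in l, M * ∫ y in (Metric.ball (0 : R3) δ)ᶜ, |κ ε y| < η / 2 := by
    have := (hconc δ hδ).const_mul M
    rw [mul_zero] at this
    exact this.eventually_lt_const (half_pos hη)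
  filter_upwards [hκ, hev] with ε ⟨hκi, hκ1⟩ hε
  obtain ⟨hi, he⟩ := nonlocalForm_eq hC0 hC hΩ hκi hf hu
  have hB : MeasurableSet (Metric.ball (0 : R3) δ)ᶜ := measurableSet_ball.compl
  have e1 : ∑ i, (∫ y : R3, y i / ‖y‖ * κ ε y) * c i =
      ∫ h : R3, ∑ i, h i / ‖h‖ * κ ε h * c i := by
    rw [integral_finsetSum _ fun i _ => (integrable_div_norm_mul hκi i).mul_const _]
    simp only [integral_mul_const]
  have hi2 : Integrable fun h : R3 => ∑ i, h i / ‖h‖ * κ ε h * c i :=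
    integrable_finsetSum _ fun i _ => (integrable_div_norm_mul hκi i).mul_const _
  rw [Real.dist_eq, sub_zero, he, e1, ← integral_sub hi hi2]
  -- Near the origin the first-order expansion gives the error $\eta/2$; away from it the mean
  -- quotient and its expected limit are only bounded by $M$ together, but the kernel has little
  -- mass there.
  have hpt : ∀ h : R3, |κ ε h * meanQuotient Ω u f h - ∑ i, h i / ‖h‖ * κ ε h * c i| ≤
      |κ ε h| * (η / 2) + M * (Metric.ball (0 : R3) δ)ᶜ.indicator (fun y => |κ ε y|) h := by
    intro h
    have e2 : κ ε h * meanQuotient Ω u f h - ∑ i, h i / ‖h‖ * κ ε h * c i =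
        κ ε h * (meanQuotient Ω u f h - ∑ i, h i / ‖h‖ * c i) := by
      rw [mul_sub, Finset.mul_sum]
      congr 1
      exact Finset.sum_congr rfl fun i _ => by ring
    rw [e2, abs_mul]
    by_cases hh : h ∈ (Metric.ball (0 : R3) δ)ᶜ
    · rw [Set.indicator_of_mem hh]
      have h1 : |meanQuotient Ω u f h - ∑ i, h i / ‖h‖ * c i| ≤ M := by
        refine (abs_sub _ _).trans (add_le_add (abs_meanQuotient_le hC0 hC hΩ hf hu h) ?_)
        refine (Finset.abs_sum_le_sum_abs _ _).trans (Finset.sum_le_sum fun i _ => ?_)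
        rw [abs_mul]
        exact mul_le_of_le_one_left (abs_nonneg _) (abs_div_norm_le h i)
      have h2 := mul_le_mul_of_nonneg_left h1 (abs_nonneg (κ ε h))
      have h3 : 0 ≤ |κ ε h| * (η / 2) := by positivity
      linarith
    · rw [Set.indicator_of_notMem hh, mul_zero, add_zero]
      refine mul_le_mul_of_nonneg_left ?_ (abs_nonneg _)
      have hh' : ‖h‖ < δ := by simpa using hh
      have h1 := mul_le_mul_of_nonneg_left (hδ' h hh') (inv_nonneg.2 (norm_nonneg h))
      rw [← abs_of_nonneg (inv_nonneg.2 (norm_nonneg h)), ← abs_mul,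
        abs_of_nonneg (inv_nonneg.2 (norm_nonneg h)), mul_sub, Finset.mul_sum] at h1
      have h2 : ‖h‖⁻¹ * (η / 2 * ‖h‖) ≤ η / 2 := by
        rw [mul_left_comm]
        exact mul_le_of_le_one_right (half_pos hη).le inv_mul_le_one
      refine le_trans (le_of_eq ?_) (h1.trans h2)
      rw [meanQuotient]
      congr 2
      exact Finset.sum_congr rfl fun i _ => by rw [div_eq_inv_mul, mul_assoc]
  refine abs_integral_le_integral_abs.trans_lt ?_
  have hi3 : Integrable (fun h => |κ ε h| * (η / 2)) := hκi.abs.mul_const _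
  have hi4 : Integrable (fun h => M * (Metric.ball (0 : R3) δ)ᶜ.indicator (fun y => |κ ε y|) h) :=
    (hκi.abs.indicator hB).const_mul _
  refine (integral_mono (hi.sub hi2).abs (hi3.add hi4) hpt).trans_lt ?_
  simp only [Pi.add_apply]
  rw [integral_add hi3 hi4, integral_mul_const, integral_const_mul, integral_indicator hB]
  nlinarith

lemma IsScalarH1.sub {f' : R3 → ℝ} {g' : Fin 3 → R3 → ℝ} (hf : IsScalarH1 Ω f g)
    (hf' : IsScalarH1 Ω f' g') : IsScalarH1 Ω (f - f') (fun i => g i - g' i) where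
  memLp := hf.memLp.sub hf'.memLp
  memLp_deriv i := (hf.memLp_deriv i).sub (hf'.memLp_deriv i)
  eq_zero x hx := by simp [hf.eq_zero x hx, hf'.eq_zero x hx]
  weakDeriv i φ hφ hφc hφΩ := by
    have m1 : MemLp φ 2 volume := hφ.continuous.memLp_of_hasCompactSupport hφc
    have m2 : MemLp (fun x => fderiv ℝ φ x (e i)) 2 volume :=
      ((hφ.continuous_fderiv (by simp)).clm_apply continuous_const).memLp_of_hasCompactSupport
        (hφc.fderiv_apply (𝕜 := ℝ) (e i))
    simp only [Pi.sub_apply, mul_sub]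
    rw [integral_sub (integrable_mul_of_memLp_two m2 hf.memLp)
      (integrable_mul_of_memLp_two m2 hf'.memLp),
      integral_sub (integrable_mul_of_memLp_two m1 (hf.memLp_deriv i))
      (integrable_mul_of_memLp_two m1 (hf'.memLp_deriv i)),
      hf.weakDeriv i φ hφ hφc hφΩ, hf'.weakDeriv i φ hφ hφc hφΩ]
    ring

/-- Convergence of the scalar nonlocal forms along converging families of functions. -/
theorem tendsto_nonlocalForm_of_tendsto {ι : Type*} {l : Filter ι} (hC0 : 0 ≤ C)
    (hC : IncrementBound Ω C) (hΩ : IsOpen Ω) (hΩ' : volume Ω ≠ ⊤) {κ : ι → R3 → ℝ}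
    {d : Fin 3 → ℝ} (hκ : ∀ᶠ ε in l, Integrable (κ ε) ∧ ∫ h, |κ ε h| ≤ 1)
    (hconc : ∀ δ > 0, Tendsto (fun ε => ∫ y in (Metric.ball (0 : R3) δ)ᶜ, |κ ε y|) l (𝓝 0))
    (hd : ∀ i, Tendsto (fun ε => ∫ y : R3, y i / ‖y‖ * κ ε y) l (𝓝 (d i)))
    (hf : IsScalarH1 Ω f g) (hu : MemLp u 2 volume) (hu0 : ∀ x ∉ Ω, u x = 0)
    {fε uε : ι → R3 → ℝ} {gε : ι → Fin 3 → R3 → ℝ}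
    (hfε : ∀ᶠ ε in l, IsScalarH1 Ω (fε ε) (gε ε)) (huε : ∀ᶠ ε in l, MemLp (uε ε) 2 volume)
    (hlu : Tendsto (fun ε => lpNorm (uε ε - u) 2 volume) l (𝓝 0))
    (hlf : Tendsto (fun ε => lpNorm (fε ε - f) 2 volume) l (𝓝 0))
    (hlg : ∀ i, Tendsto (fun ε => lpNorm (gε ε i - g i) 2 volume) l (𝓝 0)) :
    Tendsto (fun ε => nonlocalForm Ω (κ ε) (uε ε) (fε ε)) l
      (𝓝 (∑ i, d i * ∫ x, u x * g i x)) := by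
  have h1 := tendsto_nonlocalForm hC0 hC hΩ hΩ' hκ hconc hd hf hu hu0
  have hlgr : Tendsto (fun ε => gradNorm fun i => gε ε i - g i) l (𝓝 0) := by
    have := tendsto_finsetSum Finset.univ fun i _ => hlg i
    simpa [gradNorm] using this
  have hlH : Tendsto (fun ε => lpNorm (fε ε - f) 2 volume + gradNorm fun i => gε ε i - g i) l
      (𝓝 0) := by simpa using hlf.add hlgr
  set N := lpNorm f 2 volume + gradNorm g with hN
  have hb : Tendsto (fun ε => C * lpNorm (uε ε - u) 2 volume *
      (N + (lpNorm (fε ε - f) 2 volume + gradNorm fun i => gε ε i - g i)) +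
      C * lpNorm u 2 volume * (lpNorm (fε ε - f) 2 volume + gradNorm fun i => gε ε i - g i))
      l (𝓝 0) := by
    have := ((hlu.const_mul C).mul (hlH.const_add N)).add (hlH.const_mul (C * lpNorm u 2 volume))
    simpa using this
  suffices h0 : Tendsto (fun ε => nonlocalForm Ω (κ ε) (uε ε) (fε ε) - nonlocalForm Ω (κ ε) u f)
      l (𝓝 0) by
    simpa using h0.add h1
  refine squeeze_zero_norm' ?_ hb
  filter_upwards [hκ, hfε, huε] with ε ⟨hκi, hκ1⟩ hfε huε
  have hdu := huε.sub hu
  have hdf := hfε.sub hf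
  -- Bilinearity: first $u$ is varied with $f_\varepsilon$ kept, then $f$ with $u$ kept.
  have e1 : nonlocalForm Ω (κ ε) (uε ε) (fε ε) - nonlocalForm Ω (κ ε) u f =
      nonlocalForm Ω (κ ε) (uε ε - u) (fε ε) + nonlocalForm Ω (κ ε) u (fε ε - f) := by
    unfold nonlocalForm
    rw [← integral_sub (integrableOn_formIntegrand hC0 hC hΩ hκi hfε huε)
      (integrableOn_formIntegrand hC0 hC hΩ hκi hf hu),
      ← integral_add (integrableOn_formIntegrand hC0 hC hΩ hκi hfε hdu)
      (integrableOn_formIntegrand hC0 hC hΩ hκi hdf hu)]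
    congr 1; ext p
    simp [formIntegrand]; ring
  rw [e1]
  refine (norm_add_le _ _).trans (add_le_add ?_ (abs_nonlocalForm_le hC0 hC hΩ hκi hκ1 hdf hu))
  refine (abs_nonlocalForm_le hC0 hC hΩ hκi hκ1 hfε hdu).trans ?_
  refine mul_le_mul_of_nonneg_left ?_ (mul_nonneg hC0 lpNorm_nonneg)
  have h2 : lpNorm (fε ε) 2 volume ≤ lpNorm f 2 volume + lpNorm (fε ε - f) 2 volume :=
    lpNorm_le_lpNorm_add_lpNorm_sub' hf.memLp (by norm_num)
  have h3 : gradNorm (gε ε) ≤ gradNorm g + gradNorm fun i => gε ε i - g i := by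
    rw [gradNorm, gradNorm, gradNorm, ← Finset.sum_add_distrib]
    exact Finset.sum_le_sum fun i _ =>
      lpNorm_le_lpNorm_add_lpNorm_sub' (hf.memLp_deriv i) (by norm_num)
  linarith

end BilinearForm

/-! ### Reduction of the vector energies to scalar forms. -/

section Components

/-- The `a`-th component of `m` on `Ω`, extended by zero. -/
noncomputable def component (Ω : Set R3) (m : R3 → R3) (a : Fin 3) : R3 → ℝ :=
  Ω.indicator fun x => m x a

variable {Ω : Set R3} {m : R3 → R3} {Dm : Fin 3 → R3 → R3}

lemma memLp_apply {α : Type*} {mα : MeasurableSpace α} {μ : Measure α} {F : α → R3}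
    (hF : MemLp F 2 μ) (a : Fin 3) : MemLp (fun x => F x a) 2 μ :=
  (EuclideanSpace.proj (𝕜 := ℝ) a).comp_memLp' hF

lemma memLp_component (hΩ : MeasurableSet Ω) (hm : MemLp m 2 (volume.restrict Ω)) (a : Fin 3) :
    MemLp (component Ω m a) 2 volume :=
  (memLp_indicator_iff_restrict hΩ).2 (memLp_apply hm a)

lemma component_eq_zero (m : R3 → R3) (a : Fin 3) : ∀ x ∉ Ω, component Ω m a x = 0 :=
  fun _ hx => Set.indicator_of_notMem hx _

lemma integrable_smul_of_testFunction {ψ : R3 → ℝ} (hψ : Continuous ψ) (hψc : HasCompactSupport ψ)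
    {F : R3 → R3} (hF : MemLp F 2 (volume.restrict Ω)) :
    Integrable (fun x => ψ x • F x) (volume.restrict Ω) :=
  memLp_one_iff_integrable.1 (hF.smul ((hψ.memLp_of_hasCompactSupport (p := 2) hψc).restrict Ω))

lemma integral_mul_component (hΩ : MeasurableSet Ω) (ψ : R3 → ℝ) (m : R3 → R3) (a : Fin 3) :
    ∫ x, ψ x * component Ω m a x = ∫ x in Ω, ψ x * m x a := by
  rw [← integral_indicator hΩ]
  congr 1; ext x
  by_cases hx : x ∈ Ω <;> simp [component, hx]

lemma IsH1.isScalarH1 (hΩ : MeasurableSet Ω) (hm : IsH1 Ω m Dm) (a : Fin 3) :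
    IsScalarH1 Ω (component Ω m a) (fun i => component Ω (Dm i) a) where
  memLp := memLp_component hΩ hm.memLp a
  memLp_deriv i := memLp_component hΩ (hm.memLp_deriv i) a
  eq_zero := component_eq_zero m a
  weakDeriv i φ hφ hφc hφΩ := by
    have h1 := integrable_smul_of_testFunction
      ((hφ.continuous_fderiv (by simp)).clm_apply continuous_const)
      (hφc.fderiv_apply (𝕜 := ℝ) (e i)) hm.memLp
    have h2 := integrable_smul_of_testFunction hφ.continuous hφc (hm.memLp_deriv i)
    have h3 := congrArg (EuclideanSpace.proj (𝕜 := ℝ) a) (hm.weakDeriv i φ hφ hφc hφΩ)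
    rw [map_neg, ← ContinuousLinearMap.integral_comp_comm _ h1,
      ← ContinuousLinearMap.integral_comp_comm _ h2] at h3
    rw [integral_mul_component hΩ, integral_mul_component hΩ]
    simpa using h3

/-- Indices are cyclic modulo 3. The product $m_{c+1}(y)m_{c+2}(y)$ occurs in both terms and
cancels; it is what makes the differences $f(x)-f(y)$ appear. -/
lemma nonlocalIntegrand_eq (κ : R3 → R3) (m : R3 → R3) {p : R3 × R3} (hp : p ∈ Ω ×ˢ Ω) :
    nonlocalIntegrand κ m p = ∑ c : Fin 3,
      (formIntegrand (fun y => κ y c) (component Ω m (c + 2)) (component Ω m (c + 1)) p -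
        formIntegrand (fun y => κ y c) (component Ω m (c + 1)) (component Ω m (c + 2)) p) := by
  have e1 : (1 : Fin 3) + 2 = 0 := rfl
  have e2 : (2 : Fin 3) + 2 = 1 := rfl
  have e3 : (2 : Fin 3) + 1 = 0 := rfl
  have e4 : (1 : Fin 3) + 1 = 2 := rfl
  simp only [nonlocalIntegrand, formIntegrand, component, Set.indicator_of_mem hp.1,
    Set.indicator_of_mem hp.2, PiLp.inner_apply, cross, cross_apply, Fin.sum_univ_three,
    e1, e2, e3, e4, zero_add]
  simp
  ring

/-- The triple product $m\cdot(d_i\times\partial_im)=d_i\cdot(\partial_im\times m)$, indexed so as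
to match the limits of the scalar forms term by term. -/
lemma dmiIntegrand_eq (d : Fin 3 → R3) (m : R3 → R3) (Dm : Fin 3 → R3 → R3) (i : Fin 3) (x : R3) :
    dmiIntegrand d m Dm i x = ∑ c : Fin 3,
      d i c * (m x (c + 2) * Dm i x (c + 1) - m x (c + 1) * Dm i x (c + 2)) := by
  have e1 : (1 : Fin 3) + 2 = 0 := rfl
  have e2 : (2 : Fin 3) + 2 = 1 := rfl
  have e3 : (2 : Fin 3) + 1 = 0 := rfl
  have e4 : (1 : Fin 3) + 1 = 2 := rfl
  simp only [dmiIntegrand, PiLp.inner_apply, cross, cross_apply, Fin.sum_univ_three,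
    e1, e2, e3, e4, zero_add]
  simp
  ring

lemma integrable_dmiTerm (hm : IsH1 Ω m Dm) (d : Fin 3 → R3) (i c : Fin 3) :
    Integrable (fun x => d i c * (m x (c + 2) * Dm i x (c + 1) - m x (c + 1) * Dm i x (c + 2)))
      (volume.restrict Ω) :=
  ((integrable_mul_of_memLp_two (memLp_apply hm.memLp _) (memLp_apply (hm.memLp_deriv i) _)).sub
    (integrable_mul_of_memLp_two (memLp_apply hm.memLp _)
      (memLp_apply (hm.memLp_deriv i) _))).const_mul _

lemma IsH1.integrableOn_dmiIntegrand (hm : IsH1 Ω m Dm) (d : Fin 3 → R3) (i : Fin 3) :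
    IntegrableOn (dmiIntegrand d m Dm i) Ω := by
  have h := integrable_finsetSum Finset.univ fun c _ => integrable_dmiTerm hm d i c
  exact h.congr (Eventually.of_forall fun x => (dmiIntegrand_eq d m Dm i x).symm)

lemma IsH1.dmiEnergy_eq (hΩ : MeasurableSet Ω) (hm : IsH1 Ω m Dm) (d : Fin 3 → R3) :
    dmiEnergy Ω d m Dm = ∑ c : Fin 3,
      ((∑ i, d i c * ∫ x, component Ω m (c + 2) x * component Ω (Dm i) (c + 1) x) -
        ∑ i, d i c * ∫ x, component Ω m (c + 1) x * component Ω (Dm i) (c + 2) x) := by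
  have hcomp : ∀ i a b, ∫ x, component Ω m a x * component Ω (Dm i) b x =
      ∫ x in Ω, m x a * Dm i x b := fun i a b => by
    rw [integral_mul_component hΩ]
    exact setIntegral_congr_fun hΩ fun x hx => by simp [component, hx]
  simp only [dmiEnergy, dmiIntegrand_eq, hcomp]
  simp only [integral_finsetSum _ fun c _ => integrable_dmiTerm hm d _ c]
  rw [Finset.sum_comm]
  refine Finset.sum_congr rfl fun c _ => ?_
  rw [← Finset.sum_sub_distrib]
  refine Finset.sum_congr rfl fun i _ => ?_
  rw [integral_const_mul, integral_sub
    (integrable_mul_of_memLp_two (memLp_apply hm.memLp _) (memLp_apply (hm.memLp_deriv i) _))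
    (integrable_mul_of_memLp_two (memLp_apply hm.memLp _) (memLp_apply (hm.memLp_deriv i) _)),
    mul_sub]

variable {C : ℝ} {κ : R3 → R3}

lemma IsH1.integrableOn_nonlocalIntegrand_and_energy_eq (hC0 : 0 ≤ C) (hC : IncrementBound Ω C) (hΩ : IsOpen Ω)
    (hκ : Integrable κ) (hm : IsH1 Ω m Dm) :
    IntegrableOn (nonlocalIntegrand κ m) (Ω ×ˢ Ω) ∧
      nonlocalEnergy Ω κ m = ∑ c : Fin 3,
        (nonlocalForm Ω (fun y => κ y c) (component Ω m (c + 2)) (component Ω m (c + 1)) -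
        nonlocalForm Ω (fun y => κ y c) (component Ω m (c + 1)) (component Ω m (c + 2))) := by
  have hi : ∀ c a b : Fin 3, IntegrableOn
      (formIntegrand (fun y => κ y c) (component Ω m a) (component Ω m b)) (Ω ×ˢ Ω) := fun c a b =>
    integrableOn_formIntegrand hC0 hC hΩ ((EuclideanSpace.proj (𝕜 := ℝ) c).integrable_comp hκ)
      (hm.isScalarH1 hΩ.measurableSet b) (memLp_component hΩ.measurableSet hm.memLp a)
  have hmeas : MeasurableSet (Ω ×ˢ Ω) := hΩ.measurableSet.prod hΩ.measurableSet
  have hs : ∀ c : Fin 3, Integrable (fun p =>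
      formIntegrand (fun y => κ y c) (component Ω m (c + 2)) (component Ω m (c + 1)) p -
        formIntegrand (fun y => κ y c) (component Ω m (c + 1)) (component Ω m (c + 2)) p)
      (volume.restrict (Ω ×ˢ Ω)) := fun c => (hi c (c + 2) (c + 1)).sub (hi c (c + 1) (c + 2))
  constructor
  · exact IntegrableOn.congr_fun (integrable_finsetSum Finset.univ fun c _ => hs c)
      (fun p hp => (nonlocalIntegrand_eq κ m hp).symm) hmeas
  · rw [nonlocalEnergy, setIntegral_congr_fun hmeas fun p hp => nonlocalIntegrand_eq κ m hp,
      integral_finsetSum _ fun c _ => hs c]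
    exact Finset.sum_congr rfl fun c _ => integral_sub (hi c (c + 2) (c + 1)) (hi c (c + 1) (c + 2))

end Components

/-! ### Hypotheses on the kernels, component by component, and convergence of energies. -/

section Kernels

variable {ν : ℝ → R3 → R3} {d : Fin 3 → R3}

lemma OddUnitMass.integral_abs_le (h : OddUnitMass ν) (c : Fin 3) {ε : ℝ} (hε : 0 < ε) :
    Integrable (fun y => ν ε y c) ∧ ∫ y, |ν ε y c| ≤ 1 := by
  obtain ⟨-, h1, h2⟩ := h ε hε
  have h3 : Integrable fun y => ν ε y c := (EuclideanSpace.proj (𝕜 := ℝ) c).integrable_comp h1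
  exact ⟨h3, (integral_mono h3.abs h1.norm fun y => abs_apply_le_norm _ c).trans h2.le⟩

lemma ConcentratesAtZero.tendsto_component (hν : OddUnitMass ν) (h : ConcentratesAtZero ν)
    (c : Fin 3) (δ : ℝ) (hδ : 0 < δ) :
    Tendsto (fun ε => ∫ y in (Metric.ball (0 : R3) δ)ᶜ, |ν ε y c|) (𝓝[>] 0) (𝓝 0) := by
  refine squeeze_zero' (Eventually.of_forall fun ε => integral_nonneg fun y => abs_nonneg _) ?_
    (h δ hδ)
  filter_upwards [self_mem_nhdsWithin] with ε hε
  exact integral_mono (hν.integral_abs_le c hε).1.abs.integrableOn (hν ε hε).2.1.norm.integrableOn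
    fun y => abs_apply_le_norm _ c

lemma HasDzyaloshinskiiVectors.tendsto_component (hν : OddUnitMass ν)
    (h : HasDzyaloshinskiiVectors ν d) (c i : Fin 3) :
    Tendsto (fun ε => ∫ y : R3, y i / ‖y‖ * ν ε y c) (𝓝[>] 0) (𝓝 (d i c)) := by
  have h1 := ((EuclideanSpace.proj (𝕜 := ℝ) c).continuous.tendsto (d i)).comp (h i)
  refine h1.congr' ?_
  filter_upwards [self_mem_nhdsWithin] with ε hε
  have hi : Integrable fun y : R3 => (y i / ‖y‖) • ν ε y := by
    refine (hν ε hε).2.1.norm.mono' ?_ (Eventually.of_forall fun y => ?_)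
    · have : Measurable fun y : R3 => y i / ‖y‖ := by fun_prop
      exact this.aestronglyMeasurable.smul (hν ε hε).2.1.1
    · rw [norm_smul]
      exact mul_le_of_le_one_left (norm_nonneg _) (abs_div_norm_le y i)
  rw [Function.comp_apply, ← ContinuousLinearMap.integral_comp_comm _ hi]
  simp

/-- Convergence of the nonlocal energies along families converging in `H¹`. -/
theorem tendsto_nonlocalEnergy {Ω : Set R3} {C : ℝ} (hC0 : 0 ≤ C) (hC : IncrementBound Ω C)
    (hΩ : IsOpen Ω) (hΩ' : volume Ω ≠ ⊤) (hν : OddUnitMass ν) (hν' : ConcentratesAtZero ν)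
    (hd : HasDzyaloshinskiiVectors ν d) {m : R3 → R3} {Dm : Fin 3 → R3 → R3} (hm : IsH1 Ω m Dm)
    {mε : ℝ → R3 → R3} {Dmε : ℝ → Fin 3 → R3 → R3} (hmε : ∀ ε > 0, IsH1 Ω (mε ε) (Dmε ε))
    (hl : ∀ a, Tendsto (fun ε => lpNorm (component Ω (mε ε) a - component Ω m a) 2 volume)
      (𝓝[>] 0) (𝓝 0))
    (hlD : ∀ i a, Tendsto (fun ε => lpNorm (component Ω (Dmε ε i) a - component Ω (Dm i) a) 2 volume)
      (𝓝[>] 0) (𝓝 0)) :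
    Tendsto (fun ε => nonlocalEnergy Ω (ν ε) (mε ε)) (𝓝[>] 0) (𝓝 (dmiEnergy Ω d m Dm)) := by
  have hΩm := hΩ.measurableSet
  have key : ∀ c a b : Fin 3, Tendsto (fun ε => nonlocalForm Ω (fun y => ν ε y c)
      (component Ω (mε ε) a) (component Ω (mε ε) b)) (𝓝[>] 0)
      (𝓝 (∑ i, d i c * ∫ x, component Ω m a x * component Ω (Dm i) b x)) := fun c a b =>
    tendsto_nonlocalForm_of_tendsto hC0 hC hΩ hΩ'
      (eventually_nhdsWithin_of_forall fun ε hε => hν.integral_abs_le c hε)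
      (fun δ hδ => hν'.tendsto_component hν c δ hδ) (fun i => hd.tendsto_component hν c i)
      (hm.isScalarH1 hΩm b) (memLp_component hΩm hm.memLp a) (component_eq_zero m a)
      (gε := fun ε i => component Ω (Dmε ε i) b)
      (eventually_nhdsWithin_of_forall fun ε hε => (hmε ε hε).isScalarH1 hΩm b)
      (eventually_nhdsWithin_of_forall fun ε hε => memLp_component hΩm (hmε ε hε).memLp a)
      (hl a) (hl b) (fun i => hlD i b)
  rw [hm.dmiEnergy_eq hΩm]
  refine (tendsto_finsetSum Finset.univ fun c _ =>
    (key c (c + 2) (c + 1)).sub (key c (c + 1) (c + 2))).congr' ?_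
  filter_upwards [self_mem_nhdsWithin] with ε hε
  exact ((hmε ε hε).integrableOn_nonlocalIntegrand_and_energy_eq hC0 hC hΩ (hν ε hε).2.1).2.symm

end Kernels

/-! ### Maps of class $C^2$ up to the boundary as a special case of $H^1$. -/

section Smooth

variable {Ω : Set R3} {m : R3 → R3}

lemma norm_e (i : Fin 3) : ‖e i‖ = 1 := by simp [e]

lemma MemC2Closure.exists_bound (hbdd : Bornology.IsBounded Ω) (hm : MemC2Closure Ω m) {k : ℕ}
    (hk : k ≤ 2) : ∃ B, ∀ x ∈ Ω, ‖iteratedFDeriv ℝ k m x‖ ≤ B := by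
  obtain ⟨F, hF, hFm⟩ := hm.2 k hk
  obtain ⟨B, hB⟩ := hbdd.isCompact_closure.exists_bound_of_continuousOn hF
  exact ⟨B, fun x hx => hFm hx ▸ hB x (subset_closure hx)⟩

/-- A map of class `C²` up to the boundary belongs to `H¹`, with its classical derivatives. -/
lemma MemC2Closure.isH1 (hΩ : IsOpen Ω) (hbdd : Bornology.IsBounded Ω) (hm : MemC2Closure Ω m) :
    IsH1 Ω m (classicalPartials m) := by
  have : IsFiniteMeasure (volume.restrict Ω) := ⟨by simpa using hbdd.measure_lt_top⟩
  have hdiff : ∀ x ∈ Ω, DifferentiableAt ℝ m x := fun x hx =>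
    (hm.1.differentiableOn (by norm_num)).differentiableAt (hΩ.mem_nhds hx)
  obtain ⟨B0, hB0⟩ := hm.exists_bound hbdd (k := 0) (by norm_num)
  obtain ⟨B1, hB1⟩ := hm.exists_bound hbdd (k := 1) (by norm_num)
  have h0 : MemLp m 2 (volume.restrict Ω) := by
    refine MemLp.of_bound (hm.1.continuousOn.aestronglyMeasurable hΩ.measurableSet) B0 ?_
    refine (ae_restrict_iff' hΩ.measurableSet).2 (Eventually.of_forall fun x hx => ?_)
    simpa using hB0 x hx
  have h1 : ∀ i, MemLp (classicalPartials m i) 2 (volume.restrict Ω) := fun i => by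
    have hc : ContinuousOn (classicalPartials m i) Ω :=
      (hm.1.continuousOn_fderiv_of_isOpen hΩ (by norm_num)).clm_apply continuousOn_const
    refine MemLp.of_bound (hc.aestronglyMeasurable hΩ.measurableSet) B1 ?_
    refine (ae_restrict_iff' hΩ.measurableSet).2 (Eventually.of_forall fun x hx => ?_)
    have := (iteratedFDeriv ℝ 1 m x).le_opNorm fun _ => e i
    simp only [iteratedFDeriv_one_apply, Finset.univ_unique, Finset.prod_const, norm_e,
      one_pow, mul_one] at this
    exact this.trans (hB1 x hx)
  refine ⟨h0, h1, fun i φ hφ hφc hφΩ => ?_⟩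
  have hφ0 : ∀ x ∉ Ω, φ x = 0 := fun x hx => image_eq_zero_of_notMem_tsupport fun h => hx (hφΩ h)
  have hφ1 : ∀ x ∉ Ω, fderiv ℝ φ x (e i) = 0 := fun x hx => by
    rw [image_eq_zero_of_notMem_tsupport fun h => hx (hφΩ (tsupport_fderiv_subset ℝ h))]
    rfl
  have hglob : ∀ F : R3 → R3, Integrable F (volume.restrict Ω) → (∀ x ∉ Ω, F x = 0) →
      Integrable F := fun F hF hF0 =>
    (integrableOn_iff_integrable_of_support_subset fun x hx => by
      by_contra h
      exact hx (hF0 x h)).1 hF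
  have z1 : ∀ x ∉ Ω, fderiv ℝ φ x (e i) • m x = 0 := fun x hx => by rw [hφ1 x hx, zero_smul]
  have z2 : ∀ x ∉ Ω, φ x • fderiv ℝ m x (e i) = 0 := fun x hx => by rw [hφ0 x hx, zero_smul]
  -- Integration by parts on the whole space: $m$ need only be differentiable on the support of
  -- $\varphi$, and all the products vanish outside $\Omega$.
  have h := integral_smul_fderiv_eq_neg_fderiv_smul_of_integrable (μ := (volume : Measure R3))
    (f := φ) (g := m) (v := e i)
    (hglob _ (integrable_smul_of_testFunction
      ((hφ.continuous_fderiv (by simp)).clm_apply continuous_const)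
      (hφc.fderiv_apply (𝕜 := ℝ) (e i)) h0) z1)
    (hglob _ (integrable_smul_of_testFunction hφ.continuous hφc (h1 i)) z2)
    (hglob _ (integrable_smul_of_testFunction hφ.continuous hφc h0) fun x hx => by
      rw [hφ0 x hx, zero_smul])
    (fun x _ => (hφ.differentiable (by simp)) x) (fun x hx => hdiff x (hφΩ hx))
  rw [setIntegral_eq_integral_of_forall_compl_eq_zero z1]
  have h' := setIntegral_eq_integral_of_forall_compl_eq_zero (μ := (volume : Measure R3)) z2
  unfold classicalPartials
  rw [h', h, neg_neg]

/-- On a set of finite measure, uniform convergence implies $L^2$ convergence. -/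
lemma tendsto_lpNorm_component_of_uniform (hΩ : MeasurableSet Ω) (hΩ' : volume Ω ≠ ⊤)
    {F : ℝ → R3 → R3} {G : R3 → R3} {l : Filter ℝ}
    (h : ∀ η > 0, ∀ᶠ ε in l, ∀ x ∈ Ω, ‖F ε x - G x‖ ≤ η) (a : Fin 3) :
    Tendsto (fun ε => lpNorm (component Ω (F ε) a - component Ω G a) 2 volume) l (𝓝 0) := by
  set V := lpNorm (Ω.indicator fun _ => (1 : ℝ)) 2 (volume : Measure R3) with hV
  have hV0 : 0 ≤ V := lpNorm_nonneg
  have hm : MemLp (Ω.indicator fun _ => (1 : ℝ)) 2 (volume : Measure R3) :=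
    memLp_indicator_const 2 hΩ 1 (Or.inr hΩ')
  rw [Metric.tendsto_nhds]
  intro η hη
  have hη' : 0 < η / (V + 1) := by positivity
  filter_upwards [h _ hη'] with ε hε
  rw [Real.dist_eq, sub_zero, abs_of_nonneg lpNorm_nonneg]
  have h1 : lpNorm (component Ω (F ε) a - component Ω G a) 2 volume ≤ η / (V + 1) * V := by
    have h2 := lpNorm_const_smul (p := 2) (η / (V + 1)) (Ω.indicator fun _ => (1 : ℝ))
      (volume : Measure R3)
    simp only [coe_nnnorm, Real.norm_of_nonneg hη'.le] at h2
    rw [hV, ← h2]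
    refine lpNorm_mono_ae (hm.const_smul _) (Eventually.of_forall fun x => ?_)
    by_cases hx : x ∈ Ω
    · have h3 : |F ε x a - G x a| ≤ ‖F ε x - G x‖ := by
        simpa using abs_apply_le_norm (F ε x - G x) a
      simp only [component, Pi.sub_apply, Pi.smul_apply, Set.indicator_of_mem hx, smul_eq_mul,
        mul_one]
      exact (h3.trans (hε x hx)).trans (le_abs_self _)
    · simp [component, hx]
  refine h1.trans_lt ?_
  rw [div_mul_eq_mul_div, div_lt_iff₀ (by positivity)]
  nlinarith

lemma TendstoC2Closure.eventually_norm_sub_le {mε : ℝ → R3 → R3}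
    (h : TendstoC2Closure Ω mε m) {η : ℝ} (hη : 0 < η) :
    ∀ᶠ ε in 𝓝[>] 0, ∀ x ∈ Ω, ‖mε ε x - m x‖ ≤ η := by
  filter_upwards [Metric.tendstoUniformlyOn_iff.1 (h 0 (by norm_num)) η hη] with ε hε x hx
  have h1 := (iteratedFDeriv ℝ 0 m x - iteratedFDeriv ℝ 0 (mε ε) x).le_opNorm fun _ => 0
  rw [← dist_eq_norm] at h1
  have h2 := h1.trans (by simpa using (hε x hx).le)
  rw [norm_sub_rev]
  simpa using h2

lemma TendstoC2Closure.eventually_norm_partial_sub_le {mε : ℝ → R3 → R3}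
    (h : TendstoC2Closure Ω mε m) (i : Fin 3) {η : ℝ} (hη : 0 < η) :
    ∀ᶠ ε in 𝓝[>] 0, ∀ x ∈ Ω,
      ‖classicalPartials (mε ε) i x - classicalPartials m i x‖ ≤ η := by
  filter_upwards [Metric.tendstoUniformlyOn_iff.1 (h 1 (by norm_num)) η hη] with ε hε x hx
  have h1 := (iteratedFDeriv ℝ 1 m x - iteratedFDeriv ℝ 1 (mε ε) x).le_opNorm fun _ => e i
  rw [← dist_eq_norm] at h1
  simp only [_root_.sub_apply, iteratedFDeriv_one_apply, Finset.univ_unique,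
    Finset.prod_const, norm_e, one_pow, mul_one] at h1
  rw [norm_sub_rev]
  exact h1.trans (hε x hx).le

end Smooth

end NonlocalDMI

theorem theorem2p3 (Ω : Set R3) (hopen : IsOpen Ω) (hbdd : Bornology.IsBounded Ω)
    (hLip : HasLipschitzBoundary Ω) (ν : ℝ → R3 → R3) (d : Fin 3 → R3)
    (hH1 : OddUnitMass ν) (hH2 : ConcentratesAtZero ν) (hH3 : HasDzyaloshinskiiVectors ν d) :
    (∀ (m : R3 → R3) (Dm : Fin 3 → R3 → R3), IsH1 Ω m Dm →
      (∀ ε > 0, IntegrableOn (nonlocalIntegrand (ν ε) m) (Ω ×ˢ Ω)) ∧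
      (∀ i, IntegrableOn (dmiIntegrand d m Dm i) Ω) ∧
      Tendsto (fun ε => nonlocalEnergy Ω (ν ε) m) (𝓝[>] 0) (𝓝 (dmiEnergy Ω d m Dm))) ∧
    (∀ (mε : ℝ → R3 → R3) (m : R3 → R3), (∀ ε > 0, MemC2Closure Ω (mε ε)) → MemC2Closure Ω m →
      TendstoC2Closure Ω mε m →
      (∀ ε > 0, IntegrableOn (nonlocalIntegrand (ν ε) (mε ε)) (Ω ×ˢ Ω)) ∧
      (∀ i, IntegrableOn (dmiIntegrand d m (classicalPartials m) i) Ω) ∧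
      Tendsto (fun ε => nonlocalEnergy Ω (ν ε) (mε ε)) (𝓝[>] 0)
        (𝓝 (dmiEnergy Ω d m (classicalPartials m)))) := by
  obtain ⟨C, hC0, hC⟩ := exists_lpNorm_increment_le hopen hbdd hLip
  have hΩ' : volume Ω ≠ ⊤ := hbdd.measure_lt_top.ne
  refine ⟨fun m Dm hm => ⟨fun ε hε =>
    (hm.integrableOn_nonlocalIntegrand_and_energy_eq hC0 hC hopen (hH1 ε hε).2.1).1,
    hm.integrableOn_dmiIntegrand d, ?_⟩, fun mε m hmε hm hlim => ⟨fun ε hε =>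
    (((hmε ε hε).isH1 hopen hbdd).integrableOn_nonlocalIntegrand_and_energy_eq hC0 hC hopen (hH1 ε hε).2.1).1,
    (hm.isH1 hopen hbdd).integrableOn_dmiIntegrand d, ?_⟩⟩
  -- A fixed $m$ is a constant family, for which the differences vanish.
  · exact tendsto_nonlocalEnergy hC0 hC hopen hΩ' hH1 hH2 hH3 hm (mε := fun _ => m)
      (Dmε := fun _ => Dm) (fun _ _ => hm) (by simp) (by simp)
  -- Uniform convergence of the derivatives of order 0 and 1 already gives convergence in $H^1$.
  · exact tendsto_nonlocalEnergy hC0 hC hopen hΩ' hH1 hH2 hH3 (hm.isH1 hopen hbdd)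
      (Dmε := fun ε => classicalPartials (mε ε)) (fun ε hε => (hmε ε hε).isH1 hopen hbdd)
      (tendsto_lpNorm_component_of_uniform hopen.measurableSet hΩ' fun η hη =>
        hlim.eventually_norm_sub_le hη)
      (fun i => tendsto_lpNorm_component_of_uniform hopen.measurableSet hΩ' fun η hη =>
        hlim.eventually_norm_partial_sub_le i hη)
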